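/- **Setting.** Let $T$ be a *lifted space*: a connected metric space together with a topological embedding $h:\mathbb R\to T$ and a homeomorphism $\tau:T\to T$ such that (i) $\tau(h(x))=h(x+1)$ for all $x\in\mathbb R$; (ii) the closure of each connected component of $T\setminus h(\mathbb R)$ is compact and meets $h(\mathbb R)$ in exactly one point; (iii) only finitely many connected components $C$ of $T\setminus h(\mathbb R)$ satisfy $\overline C\cap h([0,1])\neq\emptyset$. Identify $\mathbb R$ with $h(\mathbb R)$ and write $x+m$ for $\tau^m(x)$ ($x\in T$, $m\in\mathbb Z$). Let $r:T\to\mathbb R$ be the natural retraction: $r(x)=x$ for $x\in\mathbb R$, and if $x$ lies in a connected component $C$ of $T\setminus\mathbb R$, then $r(x)$ is the unique point of $\overline C\cap\mathbb R$. Let $\mathcal L_1(T)$ be the set of continuous maps $F:T\to T$ with $F(x+1)=F(x)+1$ for all $x\in T$. For $F\in\mathcal L_1(T)$ and $x\in T$ let $\underline\rho_F(x)$ and $\overline\rho_F(x)$ be the $\liminf$ and the $\limsup$ of $\frac{r(F^n(x))-r(x)}{n}$ as $n\to\infty$; if they coincide (and are finite), the common value is the rotation number $\rho_F(x)$. Put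 $\mathrm{Rot}^+(F)=\{\overline\rho_F(x):x\in T\}$, $\mathrm{Rot}^-(F)=\{\underline\rho_F(x):x\in T\}$, $\mathrm{Rot}(F)=\{\rho_F(x):x\in T,\ \rho_F(x)\text{ exists}\}$ and $\mathrm{Rot}_{\mathbb R}(F)=\{\rho_F(x):x\in\mathbb R,\ \rho_F(x)\text{ exists}\}$. Let $F^r_1=r\circ F|_{\mathbb R}:\mathbb R\to\mathbb R$, with $\mathrm{Rot}(F_1^r)$ the set of existing limits $\lim_n ((F_1^r)^n(x)-x)/n$, $x\in\mathbb R$. Define $F_u,F_l:\mathbb R\to\mathbb R$ by $$F_u(x)=\sup\{r(F(y)):y\in T,\ r(y)\le x\},\qquad F_l(x)=\inf\{r(F(y)):y\in T,\ r(y)\ge x\}.$$ For $g=F_l$ or $g=F_u$, $\rho(g)$ denotes the limit $\lim_n (g^n(x)-x)/n$, when it exists for every $x\in\mathbb R$ and does not depend on $x$. The map $F$ is *combed* if for every $x\in\mathbb R$ the set $r(F(r^{-1}(x)))$ is contained both in $r(F(\{y\in\mathbb R:y\le x\}))$ and in $r(F(\{y\in\mathbb R:y\ge x\}))$. An *orbit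 (mod 1)* of $F$ is a set $\{F^n(x)+m:n\ge0,\ m\in\mathbb Z\}$ with $x\in T$; it is *periodic (mod 1)* if $x$ can be chosen with $F^n(x)\in x+\mathbb Z$ for some $n\ge1$; an orbit (mod 1) $P\subset\mathbb R$ is *twist* if $F|_P$ is strictly increasing. $\mathrm{Const}(F|_{\mathbb R})$ is the set of $x\in\mathbb R$ such that $F|_{\mathbb R}$ is constant in a neighbourhood of $x$ in $\mathbb R$. **Theorem.** Let $F\in\mathcal L_1(T)$ be combed. Then $\rho(F_l)$ and $\rho(F_u)$ exist, $\rho(F_l)\le\rho(F_u)$, and: (a) $\mathrm{Rot}(F)=\mathrm{Rot}(F^r_1)=\mathrm{Rot}_{\mathbb R}(F)=\mathrm{Rot}^+(F)=\mathrm{Rot}^-(F)=[\rho(F_l),\rho(F_u)]$. (b) For every $\alpha\in\mathrm{Rot}(F)$ there is a twist orbit (mod 1) $P\subset\mathbb R$ of $F$, disjoint from $\mathrm{Const}(F|_{\mathbb R})$, all of whose points have rotation number $\alpha$. (c) For every $\alpha\in\mathbb Q\cap\mathrm{Rot}(F)$ the orbit in (b) can be taken periodic (mod 1). (d) $\rho(F_l)$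 and $\rho(F_u)$ depend continuously on $F$: suppose that the distance $\delta$ of $T$ is $\tau$-invariant, and put $\nu(x,y)=\delta(x,y)$ if $x,y$ lie in the same connected component of $T\setminus\mathbb R$, $\nu(x,y)=\delta(x,r(x))+|r(x)-r(y)|+\delta(r(y),y)$ otherwise, and $d(F,G)=\sup_{x\in T}\nu(F(x),G(x))$. Then for every $\varepsilon>0$ there is $\eta>0$ such that for all $G\in\mathcal L_1(T)$ with $d(F,G)<\eta$ the numbers $\rho(G_l),\rho(G_u)$ exist and $|\rho(G_l)-\rho(F_l)|<\varepsilon$, $|\rho(G_u)-\rho(F_u)|<\varepsilon$. -/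

import Mathlib

open Set Filter Topology
open scoped ENNReal

/-- A lifted space: a connected metric space `T` with a copy `h(ℝ)` of the real line and a
homeomorphism `τ` of `T` extending the translation `h x ↦ h (x + 1)`. The connected components of
`T \ h(ℝ)` are the sets `connectedComponentIn (range h)ᶜ x` with `x ∉ range h`. -/
structure LiftedSpace (T : Type*) [MetricSpace T] where
  h : ℝ → T
  τ : T ≃ₜ T
  connected : ConnectedSpace T
  isEmbedding_h : IsEmbedding h
  τ_h : ∀ x : ℝ, τ (h x) = h (x + 1)
  compact_closure : ∀ x ∉ range h, IsCompact (closure (connectedComponentIn (range h)ᶜ x))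
  closure_inter : ∀ x ∉ range h,
    ∃ t : ℝ, closure (connectedComponentIn (range h)ᶜ x) ∩ range h = {h t}
  finite_components :
    {C : Set T | (∃ x ∉ range h, C = connectedComponentIn (range h)ᶜ x) ∧
      (closure C ∩ h '' Icc 0 1).Nonempty}.Finite

/-- `HasRotationNumber g a`: the rotation number of every point under `g : ℝ → ℝ` exists and is
equal to `a`. For `g = F_l`, `F_u` this says `ρ(g) = a`. -/
def HasRotationNumber (g : ℝ → ℝ) (a : ℝ) : Prop :=
  ∀ x : ℝ, Tendsto (fun n : ℕ => (g^[n] x - x) / n) atTop (𝓝 a)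

/-- The rotation set of a self-map of `ℝ`. -/
def realRotSet (g : ℝ → ℝ) : Set ℝ :=
  {α | ∃ x : ℝ, Tendsto (fun n : ℕ => (g^[n] x - x) / n) atTop (𝓝 α)}

/-- The points in a neighbourhood of which `g` is constant. -/
def constSet {X Y : Type*} [TopologicalSpace X] (g : X → Y) : Set X :=
  {x | ∀ᶠ y in 𝓝 x, g y = g x}

namespace LiftedSpace

variable {T : Type*} [MetricSpace T] (L : LiftedSpace T)

open Classical in
/-- The natural retraction, with values read in `ℝ` through `h`. -/
noncomputable def r (x : T) : ℝ :=
  if hx : x ∈ range L.h then hx.choose else (L.closure_inter x hx).choose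

/-- Continuous maps of degree one. -/
def IsDegreeOne (F : T → T) : Prop :=
  Continuous F ∧ ∀ x, F (L.τ x) = L.τ (F x)

/-- The displacement averages `(r (Fⁿ x) - r x) / n`. -/
noncomputable def avg (F : T → T) (x : T) (n : ℕ) : ℝ :=
  (L.r (F^[n] x) - L.r x) / n

/-- The upper rotation number of a point. -/
noncomputable def upperRot (F : T → T) (x : T) : EReal :=
  limsup (fun n : ℕ => (L.avg F x n : EReal)) atTop

/-- The lower rotation number of a point. -/
noncomputable def lowerRot (F : T → T) (x : T) : EReal :=
  liminf (fun n : ℕ => (L.avg F x n : EReal)) atTop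

/-- The rotation number of `x` exists and is the real number `α`. -/
def HasRot (F : T → T) (x : T) (α : ℝ) : Prop :=
  L.lowerRot F x = α ∧ L.upperRot F x = α

/-- `Rot(F)`. -/
def rotSet (F : T → T) : Set ℝ := {α | ∃ x : T, L.HasRot F x α}

/-- `Rot_ℝ(F)`. -/
def rotSetR (F : T → T) : Set ℝ := {α | ∃ t : ℝ, L.HasRot F (L.h t) α}

/-- `Rot⁺(F)`. -/
def rotSetPlus (F : T → T) : Set EReal := range (L.upperRot F)

/-- `Rot⁻(F)`. -/
def rotSetMinus (F : T → T) : Set EReal := range (L.lowerRot F)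

/-- `F₁ʳ = r ∘ F|ℝ`. -/
noncomputable def retract (F : T → T) (t : ℝ) : ℝ := L.r (F (L.h t))

/-- `F_u`. -/
noncomputable def upper (F : T → T) (x : ℝ) : ℝ := sSup {v | ∃ y : T, L.r y ≤ x ∧ v = L.r (F y)}

/-- `F_l`. -/
noncomputable def lower (F : T → T) (x : ℝ) : ℝ := sInf {v | ∃ y : T, x ≤ L.r y ∧ v = L.r (F y)}

def LeftCombedAt (F : T → T) (x : ℝ) : Prop :=
  (fun y => L.r (F y)) '' (L.r ⁻¹' {x}) ⊆ (fun y => L.r (F y)) '' (L.h '' Iic x)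

def RightCombedAt (F : T → T) (x : ℝ) : Prop :=
  (fun y => L.r (F y)) '' (L.r ⁻¹' {x}) ⊆ (fun y => L.r (F y)) '' (L.h '' Ici x)

def Combed (F : T → T) : Prop := ∀ x : ℝ, L.LeftCombedAt F x ∧ L.RightCombedAt F x

/-- The orbit (mod 1) of `x`. -/
def orb (F : T → T) (x : T) : Set T := {y | ∃ (n : ℕ) (m : ℤ), y = (L.τ ^ m) (F^[n] x)}

/-- `x` is periodic (mod 1). -/
def IsPeriodicPt (F : T → T) (x : T) : Prop :=
  ∃ n : ℕ, 1 ≤ n ∧ ∃ m : ℤ, F^[n] x = (L.τ ^ m) x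

/-- `P` is an orbit (mod 1) of `F` contained in the real line on which `F` is strictly increasing
(such an orbit is mapped by `F` into the real line, where `r` is the identity). -/
def IsTwistOrbit (F : T → T) (P : Set T) : Prop :=
  (∃ x : T, P = L.orb F x) ∧ P ⊆ range L.h ∧ StrictMonoOn (L.retract F) (L.h ⁻¹' P)

/-- `P` is a periodic (mod 1) orbit (mod 1) of `F`. -/
def IsPeriodicOrbit (F : T → T) (P : Set T) : Prop :=
  ∃ x : T, L.IsPeriodicPt F x ∧ P = L.orb F x

open Classical in
/-- The taxicab-like distance on `T`. -/
noncomputable def ν (x y : T) : ℝ :=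
  if x ∉ range L.h ∧ y ∈ connectedComponentIn (range L.h)ᶜ x then dist x y
  else dist x (L.h (L.r x)) + |L.r x - L.r y| + dist (L.h (L.r y)) y

/-- The sup distance on maps with respect to `ν`. -/
noncomputable def supDist (F G : T → T) : ℝ≥0∞ := ⨆ x : T, ENNReal.ofReal (L.ν (F x) (G x))

end LiftedSpace

/-! ### Degree one maps of the real line -/

/-! Everything reduces to the real map φ = r ∘ F|ℝ. Combing says that each value of r ∘ F over a
point x is already taken on the line on both sides of x. Hence F_u and F_l are the running supremum
and infimum of φ. These are continuous, nondecreasing and of degree one, so they have translation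
numbers. Since F_l^n(r y) ≤ r(F^n y) ≤ F_u^n(r y), all rotation numbers lie between them.

Conversely, the water functions (`water`) form a family of continuous nondecreasing degree one maps,
1-Lipschitz in μ, joining F_l to F_u. Translation numbers are continuous, so every α in the interval
is realised by some f_μ. Where f_μ is not locally constant it equals φ, and φ is not locally
constant either (`eq_water_of_notMem_constSet`). An orbit of f_μ avoiding its flat pieces exists by
compactness, and can be taken periodic mod 1 when α is rational. It is then a strictly increasing
orbit of φ.

To return to F: if F(h t) is off the line, then r ∘ F ∘ h is constant near t, because F stays in one
component for a while. An orbit of φ avoiding the flat pieces of φ is therefore an orbit of F. This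
uses continuity of r along paths. It comes from closedness of r⁻¹(compact), a Baire argument, and
the impossibility of running to infinity in finite time (`continuous_r_comp`). -/

theorem exists_abs_sub_le_of_map_add_one {ψ : ℝ → ℝ} (hc : Continuous ψ)
    (h1 : ∀ x, ψ (x + 1) = ψ x + 1) : ∃ B, ∀ x, |ψ x - x| ≤ B := by
  have hp : Function.Periodic (fun x => ψ x - x) 1 := fun x => by simp only [h1]; ring
  obtain ⟨B, hB⟩ := (isCompact_Icc (a := (0 : ℝ)) (b := 1)).exists_bound_of_continuousOn
    (f := fun x => ψ x - x) (by fun_prop)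
  refine ⟨B, fun x => ?_⟩
  obtain ⟨y, hy, hxy⟩ := hp.exists_mem_Ico₀ one_pos x
  have := hB y (Ico_subset_Icc_self hy)
  rw [hxy]
  exact this

/-- The running supremum. -/
noncomputable def runSup (ψ : ℝ → ℝ) (x : ℝ) : ℝ := sSup (ψ '' Iic x)

/-- The running infimum, taken to the right. -/
noncomputable def runInf (ψ : ℝ → ℝ) (x : ℝ) : ℝ := sInf (ψ '' Ici x)

theorem runSup_bddAbove {ψ : ℝ → ℝ} {B : ℝ} (hB : ∀ x, |ψ x - x| ≤ B) (x : ℝ) :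
    BddAbove (ψ '' Iic x) := by
  refine ⟨x + B, ?_⟩
  rintro _ ⟨y, hy, rfl⟩
  have := (abs_le.1 (hB y)).2
  have hy' : y ≤ x := hy
  linarith

theorem runSup_le {ψ : ℝ → ℝ} {x v : ℝ} (h : ∀ y ≤ x, ψ y ≤ v) : runSup ψ x ≤ v :=
  csSup_le ⟨_, mem_image_of_mem _ self_mem_Iic⟩ (by rintro _ ⟨y, hy, rfl⟩; exact h y hy)

theorem le_runSup {ψ : ℝ → ℝ} {B : ℝ} (hB : ∀ x, |ψ x - x| ≤ B) {x y : ℝ} (h : y ≤ x) :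
    ψ y ≤ runSup ψ x :=
  le_csSup (runSup_bddAbove hB x) ⟨y, h, rfl⟩

/-- Conjugation by x ↦ -x exchanges the two constructions, so facts about `runSup` transfer to
`runInf`. -/
theorem runInf_eq_neg_runSup (ψ : ℝ → ℝ) (x : ℝ) :
    runInf ψ x = - runSup (fun t => - ψ (-t)) (-x) := by
  rw [runInf, runSup, Real.sInf_def]
  congr 2
  ext v
  constructor
  · rintro ⟨y, hy, hv⟩
    exact ⟨-y, mem_Iic.2 (neg_le_neg (mem_Ici.1 hy)), by simp [hv]⟩
  · rintro ⟨y, hy, hv⟩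
    exact ⟨-y, by simpa using le_neg.1 hy, by simp [← hv]⟩

theorem runSup_mono {ψ : ℝ → ℝ} {B : ℝ} (hB : ∀ x, |ψ x - x| ≤ B) : Monotone (runSup ψ) :=
  fun _ _ hxy => runSup_le fun _ hz => le_runSup hB (hz.trans hxy)

theorem runSup_add_one {ψ : ℝ → ℝ} {B : ℝ} (hB : ∀ x, |ψ x - x| ≤ B)
    (h1 : ∀ x, ψ (x + 1) = ψ x + 1) (x : ℝ) : runSup ψ (x + 1) = runSup ψ x + 1 := by
  apply le_antisymm
  · refine runSup_le fun y hy => ?_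
    have h := le_runSup hB (x := x) (y := y - 1) (by linarith)
    have h2 := h1 (y - 1)
    rw [sub_add_cancel] at h2
    linarith
  · rw [← le_sub_iff_add_le]
    refine runSup_le fun y hy => ?_
    have h := le_runSup hB (x := x + 1) (y := y + 1) (by linarith)
    rw [h1] at h
    linarith

theorem runSup_le_max {ψ : ℝ → ℝ} {B : ℝ} (hB : ∀ x, |ψ x - x| ≤ B) {s t v : ℝ}
    (h : ∀ y ∈ Ioc s t, ψ y ≤ v) : runSup ψ t ≤ max (runSup ψ s) v :=
  runSup_le fun y hy => (le_or_gt y s).elim (fun hs => le_max_of_le_left (le_runSup hB hs))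
    fun hs => le_max_of_le_right (h y ⟨hs, hy⟩)

theorem runSup_continuous {ψ : ℝ → ℝ} {B : ℝ} (hB : ∀ x, |ψ x - x| ≤ B) (hc : Continuous ψ) :
    Continuous (runSup ψ) := by
  rw [Metric.continuous_iff]
  intro x ε hε
  obtain ⟨δ, hδ, h⟩ := Metric.continuous_iff.1 hc x (ε / 3) (by linarith)
  refine ⟨δ, hδ, fun y hy => ?_⟩
  simp only [Real.dist_eq] at *
  have key : ∀ s t, |s - x| < δ → |t - x| < δ → runSup ψ t ≤ runSup ψ s + 2 * (ε / 3) := by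
    intro s t hs ht
    have h1 := runSup_le_max hB (s := s) (t := t) (v := ψ x + ε / 3) fun y hy => by
      have := h y (abs_lt.2 ⟨by linarith [(abs_lt.1 hs).1, hy.1], by
        linarith [(abs_lt.1 ht).2, hy.2]⟩)
      linarith [(abs_lt.1 this).2]
    have h2 := (abs_lt.1 (h s hs)).1
    have h3 := le_runSup hB (le_refl s)
    refine h1.trans (max_le (by linarith) (by linarith))
  have hx : |x - x| < δ := by simpa
  have h1 := key x y hx hy
  have h2 := key y x hy hx
  exact abs_lt.2 ⟨by linarith, by linarith⟩

/-- Where the running supremum differs from the function it is locally constant. -/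
theorem mem_constSet_runSup {ψ : ℝ → ℝ} {B : ℝ} (hB : ∀ x, |ψ x - x| ≤ B) (hc : Continuous ψ)
    {x : ℝ} (hx : ψ x < runSup ψ x) : x ∈ constSet (runSup ψ) := by
  -- Near x the values of ψ stay below the level w, which is below the supremum already reached, so
  -- they cannot raise it.
  obtain ⟨w, hw, hw'⟩ := exists_between hx
  obtain ⟨δ, hδ, h⟩ := Metric.eventually_nhds_iff.1 (hc.continuousAt.eventually_lt_const hw)
  refine Metric.eventually_nhds_iff.2 ⟨δ, hδ, fun y hy => ?_⟩
  simp only [Real.dist_eq] at *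
  have key : ∀ s t, |s - x| < δ → |t - x| < δ → runSup ψ t ≤ max (runSup ψ s) w := by
    intro s t hs ht
    refine runSup_le_max hB fun y hy => (h (abs_lt.2 ⟨by linarith [(abs_lt.1 hs).1, hy.1], by
        linarith [(abs_lt.1 ht).2, hy.2]⟩)).le
  have hx' : |x - x| < δ := by simpa
  have h1 := key x y hx' hy
  have h2 := key y x hy hx'
  rw [max_eq_left hw'.le] at h1
  rcases le_max_iff.1 h2 with h2 | h2
  · exact le_antisymm h1 h2
  · exact absurd h2 (not_le.2 hw')

/-! ### The running infimum, by reflection -/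

section RunInf

variable {ψ : ℝ → ℝ} {B : ℝ}

theorem reflect_bound (hB : ∀ x, |ψ x - x| ≤ B) (x : ℝ) : |(- ψ (-x)) - x| ≤ B := by
  have := hB (-x)
  rw [← abs_neg] at this
  convert this using 2
  ring

theorem runInf_le (hB : ∀ x, |ψ x - x| ≤ B) {x y : ℝ} (h : x ≤ y) : runInf ψ x ≤ ψ y := by
  rw [runInf_eq_neg_runSup]
  have := le_runSup (reflect_bound hB) (x := -x) (y := -y) (by linarith)
  simp only [neg_neg] at this
  linarith

theorem le_runInf {x v : ℝ} (h : ∀ y, x ≤ y → v ≤ ψ y) : v ≤ runInf ψ x :=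
  le_csInf ⟨_, mem_image_of_mem _ self_mem_Ici⟩ (by rintro _ ⟨y, hy, rfl⟩; exact h y hy)

theorem runInf_mono (hB : ∀ x, |ψ x - x| ≤ B) : Monotone (runInf ψ) :=
  fun _ _ hxy => le_runInf fun _ hz => runInf_le hB (hxy.trans hz)

theorem runInf_add_one (hB : ∀ x, |ψ x - x| ≤ B)
    (h1 : ∀ x, ψ (x + 1) = ψ x + 1) (x : ℝ) : runInf ψ (x + 1) = runInf ψ x + 1 := by
  have h := runSup_add_one (reflect_bound hB) (fun x => by
    have := h1 (-(x + 1))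
    rw [show -(x + 1) + 1 = -x by ring] at this
    rw [this]; ring) (-(x + 1))
  rw [show -(x + 1) + 1 = -x by ring] at h
  rw [runInf_eq_neg_runSup, runInf_eq_neg_runSup, h]
  ring

theorem runInf_continuous (hB : ∀ x, |ψ x - x| ≤ B) (hc : Continuous ψ) :
    Continuous (runInf ψ) := by
  have h := runSup_continuous (reflect_bound hB) (hc.comp continuous_neg).neg
  have : runInf ψ = fun x => - runSup (fun t => - ψ (-t)) (-x) :=
    funext (runInf_eq_neg_runSup ψ)
  rw [this]
  exact (h.comp continuous_neg).neg

theorem mem_constSet_runInf (hB : ∀ x, |ψ x - x| ≤ B) (hc : Continuous ψ)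
    {x : ℝ} (hx : runInf ψ x < ψ x) : x ∈ constSet (runInf ψ) := by
  have h := mem_constSet_runSup (reflect_bound hB) (hc.comp continuous_neg).neg (x := -x) (by
    rw [runInf_eq_neg_runSup] at hx
    simp only [neg_neg]
    exact neg_lt.1 hx)
  have h2 := (continuous_neg.continuousAt (x := x)).eventually h
  refine h2.mono fun y hy => ?_
  rw [runInf_eq_neg_runSup, runInf_eq_neg_runSup]
  exact congrArg Neg.neg hy

end RunInf

/-! ### Water functions -/

/-- The monotone maps interpolating between `runInf φ` and `runSup φ`. -/
noncomputable def water (φ : ℝ → ℝ) (μ : ℝ) : ℝ → ℝ :=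
  runSup fun y => min (φ y) (runInf φ y + μ)

section Water

variable {φ : ℝ → ℝ}

theorem exists_water_bound (hc : Continuous φ) (h1 : ∀ x, φ (x + 1) = φ x + 1) (μ : ℝ) :
    ∃ B, ∀ x, |min (φ x) (runInf φ x + μ) - x| ≤ B := by
  obtain ⟨B, hB⟩ := exists_abs_sub_le_of_map_add_one hc h1
  refine exists_abs_sub_le_of_map_add_one (hc.min ((runInf_continuous hB hc).add_const μ)) ?_
  intro x
  rw [h1, runInf_add_one hB h1, ← min_add_add_right]
  congr 1
  ring

/-- A water function as a lift of a degree one map. -/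
theorem exists_water_lift (hc : Continuous φ) (h1 : ∀ x, φ (x + 1) = φ x + 1) (μ : ℝ) :
    ∃ f : CircleDeg1Lift, Continuous f ∧ ∀ x, f x = water φ μ x := by
  obtain ⟨B, hB⟩ := exists_abs_sub_le_of_map_add_one hc h1
  obtain ⟨B', hB'⟩ := exists_water_bound hc h1 μ
  refine ⟨⟨⟨water φ μ, runSup_mono hB'⟩, runSup_add_one hB' fun x => ?_⟩,
    runSup_continuous hB' (hc.min ((runInf_continuous hB hc).add_const μ)), fun _ => rfl⟩
  rw [h1, runInf_add_one hB h1, ← min_add_add_right]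
  congr 1
  ring

/-- Raising the cap by |μ - μ'| raises the capped function, and so its running supremum, by at most
that amount. This gives uniform continuity in μ. -/
theorem water_le_add (hc : Continuous φ) (h1 : ∀ x, φ (x + 1) = φ x + 1) (μ μ' x : ℝ) :
    water φ μ x ≤ water φ μ' x + |μ - μ'| := by
  obtain ⟨B', hB'⟩ := exists_water_bound hc h1 μ'
  refine runSup_le fun y hy => ?_
  have h := le_runSup hB' hy
  refine le_trans ?_ (add_le_add_left h _)
  rw [← min_add_add_right]
  exact min_le_min (by linarith [abs_nonneg (μ - μ')]) (by linarith [le_abs_self (μ - μ')])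

theorem water_zero (hc : Continuous φ) (h1 : ∀ x, φ (x + 1) = φ x + 1) :
    water φ 0 = runInf φ := by
  obtain ⟨B, hB⟩ := exists_abs_sub_le_of_map_add_one hc h1
  have hm : (fun y => min (φ y) (runInf φ y + 0)) = runInf φ := by
    ext y
    rw [add_zero, min_eq_right (runInf_le hB le_rfl)]
  obtain ⟨B', hB'⟩ := exists_water_bound hc h1 0
  ext x
  rw [water]
  refine le_antisymm (runSup_le fun y hy => ?_) ?_
  · have := congrFun hm y
    rw [this]
    exact runInf_mono hB hy
  · have := le_runSup hB' (le_refl x)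
    have h2 := congrFun hm x
    rwa [h2] at this

theorem exists_water_eq_runSup (hc : Continuous φ) (h1 : ∀ x, φ (x + 1) = φ x + 1) :
    ∃ M, 0 ≤ M ∧ water φ M = runSup φ := by
  obtain ⟨B, hB⟩ := exists_abs_sub_le_of_map_add_one hc h1
  have hB0 : 0 ≤ B := (abs_nonneg _).trans (hB 0)
  -- Since φ y ≤ y + B and `runInf φ y` ≥ y - B, a cap at height 2B is never active.
  refine ⟨2 * B, by linarith, ?_⟩
  rw [water]
  congr 1
  ext y
  refine min_eq_left ?_
  have : y - B ≤ runInf φ y := le_runInf fun z hz => by linarith [(abs_le.1 (hB z)).1]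
  linarith [(abs_le.1 (hB y)).2]

/-- A water function can leave φ in two ways: by exceeding the capped function, or by following the
cap strictly below φ. A running extremum is flat where it differs from its function, so both ways
force local constancy. -/
theorem eq_water_of_notMem_constSet (hc : Continuous φ) (h1 : ∀ x, φ (x + 1) = φ x + 1)
    {μ : ℝ} (hμ : 0 ≤ μ) {x : ℝ} (hx : x ∉ constSet (water φ μ)) :
    water φ μ x = φ x ∧ x ∉ constSet φ := by
  obtain ⟨B, hB⟩ := exists_abs_sub_le_of_map_add_one hc h1
  obtain ⟨B', hB'⟩ := exists_water_bound hc h1 μ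
  have hlc := runInf_continuous hB hc
  have hψc : Continuous fun y => min (φ y) (runInf φ y + μ) := hc.min (hlc.add_const μ)
  have hmono : Monotone (water φ μ) := runSup_mono hB'
  have e1 : water φ μ x = min (φ x) (runInf φ x + μ) := by
    refine le_antisymm (not_lt.1 fun h => hx (mem_constSet_runSup hB' hψc h)) ?_
    exact le_runSup hB' (le_refl x)
  have e2 : water φ μ x = φ x := by
    rw [e1, min_eq_left_iff]
    -- As μ ≥ 0, the cap being active puts x where `runInf φ` is below φ and hence flat. The capped
    -- function is then constant near x, and so is its running supremum.
    by_contra! hlt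
    have hcl : x ∈ constSet (runInf φ) := mem_constSet_runInf hB hc (by linarith)
    have hev : ∀ᶠ y in 𝓝 x, runInf φ y + μ < φ y :=
      (hlc.add_const μ).continuousAt.eventually_lt hc.continuousAt hlt
    obtain ⟨δ, hδ, h⟩ := Metric.eventually_nhds_iff.1 (hcl.and hev)
    rw [min_eq_right hlt.le] at e1
    refine hx (Metric.eventually_nhds_iff.2 ⟨δ, hδ, fun y hy => ?_⟩)
    have hψ : ∀ z, dist z x < δ → min (φ z) (runInf φ z + μ) = water φ μ x := fun z hz => by
      rw [min_eq_right (h hz).2.le, (h hz).1, e1]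
    have hge : water φ μ x ≤ water φ μ y := by
      have := le_runSup hB' (le_refl y)
      rwa [hψ y hy] at this
    refine le_antisymm ?_ hge
    have := runSup_le_max hB' (s := x) (t := y) (v := water φ μ x) fun z hz => (hψ z (by
      rw [Real.dist_eq] at *
      exact abs_lt.2 ⟨by linarith [hz.1], by linarith [hz.2, (abs_lt.1 hy).2]⟩)).le
    exact this.trans (max_le le_rfl le_rfl)
  refine ⟨e2, fun hcx => hx ?_⟩
  obtain ⟨δ, hδ, h⟩ := Metric.eventually_nhds_iff.1 hcx
  refine Metric.eventually_nhds_iff.2 ⟨δ, hδ, fun y hy => ?_⟩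
  rcases le_total x y with hxy | hxy
  · refine le_antisymm ?_ (hmono hxy)
    have := runSup_le_max hB' (s := x) (t := y) (v := water φ μ x) fun z hz => by
      refine (min_le_left _ _).trans ?_
      rw [e2, h (y := z)]
      rw [Real.dist_eq] at *
      exact abs_lt.2 ⟨by linarith [hz.1], by linarith [hz.2, (abs_lt.1 hy).2]⟩
    exact this.trans (max_le le_rfl le_rfl)
  · refine le_antisymm (hmono hxy) ?_
    refine le_trans ?_ (le_runSup hB' (le_refl y))
    rw [e1, h hy]
    refine min_le_min le_rfl (by
      gcongr
      -- To the left of x, φ keeps the value φ x up to x, so the infimum over [y, ∞) is no smaller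
      -- than the one over [x, ∞).
      refine le_runInf fun z hz => ?_
      rcases le_total x z with hz' | hz'
      · exact runInf_le hB hz'
      · rw [h (y := z)]
        · exact runInf_le hB le_rfl
        rw [Real.dist_eq] at *
        exact abs_lt.2 ⟨by linarith [(abs_lt.1 hy).1], by linarith [(abs_lt.1 hy).2]⟩)

end Water

/-! ### Translation numbers -/

namespace CircleDeg1Lift

theorem exists_iterate_near (f : CircleDeg1Lift) (hf : Continuous f) (n : ℕ) :
    ∀ δ > 0, ∃ η > 0, ∀ g : CircleDeg1Lift, (∀ x, |g x - f x| ≤ η) →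
      |g^[n] 0 - f^[n] 0| < δ := by
  induction n with
  | zero => exact fun δ hδ => ⟨1, one_pos, fun g _ => by simpa⟩
  | succ n ih =>
    intro δ hδ
    obtain ⟨δ', hδ', h⟩ := Metric.continuous_iff.1 hf (f^[n] 0) (δ / 2) (by linarith)
    obtain ⟨η, hη, h'⟩ := ih δ' hδ'
    refine ⟨min η (δ / 3), lt_min hη (by linarith), fun g hg => ?_⟩
    have h1 := h _ (h' g fun x => (hg x).trans (min_le_left _ _))
    have h2 := (hg (g^[n] 0)).trans (min_le_right _ _)
    rw [Real.dist_eq] at h1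
    rw [Function.iterate_succ_apply', Function.iterate_succ_apply']
    have h3 := abs_sub_le (g (g^[n] 0)) (f (g^[n] 0)) (f (f^[n] 0))
    linarith

/-- The translation number is continuous, for the uniform distance, at continuous maps. -/
theorem exists_translationNumber_near (f : CircleDeg1Lift) (hf : Continuous f) {ε : ℝ}
    (hε : 0 < ε) : ∃ η > 0, ∀ g : CircleDeg1Lift, (∀ x, |g x - f x| ≤ η) →
      |g.translationNumber - f.translationNumber| < ε := by
  -- For each map the n-th iterate of 0 is within 1 of n times the translation number. If the two
  -- iterates are also within 1 of each other, the translation numbers differ by at most 3 / n.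
  obtain ⟨n, hn⟩ := exists_nat_gt (3 / ε)
  have hn0 : (0 : ℝ) < n := lt_trans (by positivity) hn
  obtain ⟨η, hη, h⟩ := exists_iterate_near f hf n 1 one_pos
  refine ⟨η, hη, fun g hg => ?_⟩
  have h1 := f.dist_pow_map_zero_mul_translationNumber_le n
  have h2 := g.dist_pow_map_zero_mul_translationNumber_le n
  have h3 := h g hg
  rw [Real.dist_eq, coe_pow] at h1 h2
  rw [div_lt_iff₀ hε] at hn
  rw [abs_le] at h1 h2
  rw [abs_lt] at h3 ⊢
  constructor
  · by_contra! hlt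
    nlinarith
  · by_contra! hlt
    nlinarith

theorem hasRotationNumber (f : CircleDeg1Lift) : HasRotationNumber f f.translationNumber := by
  intro x
  simpa [coe_pow] using f.tendsto_translationNumber x

/-- Once an orbit meets a flat piece, all later iterates are flat at the starting point. Avoiding
flat pieces up to time n thus reduces to one condition on the n-th iterate. -/
theorem mem_constSet_iterate (f : CircleDeg1Lift) (hf : Continuous f) {x : ℝ} {i n : ℕ}
    (hin : i < n) (h : f^[i] x ∈ constSet f) : x ∈ constSet (f^[n]) := by
  have hev : ∀ᶠ y in 𝓝 x, f (f^[i] y) = f (f^[i] x) :=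
    ((hf.iterate i).continuousAt (x := x)).eventually h
  refine hev.mono fun y hy => ?_
  obtain ⟨k, rfl⟩ := Nat.exists_eq_add_of_lt hin
  rw [show i + k + 1 = k + (i + 1) by ring, Function.iterate_add_apply,
    Function.iterate_add_apply f k, Function.iterate_succ_apply', hy,
    Function.iterate_succ_apply']

theorem isOpen_constSet (f : ℝ → ℝ) : IsOpen (constSet f) := by
  rw [isOpen_iff_eventually]
  intro x hx
  refine (eventually_eventually_nhds.2 hx).mp (hx.mono fun y hy h => ?_)
  exact h.mono fun z hz => hz.trans hy.symm

/-- Otherwise, by periodicity, the map would be locally constant on the connected line, hence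
constant, against degree one. -/
theorem exists_notMem_constSet (f : CircleDeg1Lift) : ∃ x ∈ Icc (0 : ℝ) 1, x ∉ constSet f := by
  by_contra! h
  have hall : ∀ x, x ∈ constSet f := by
    intro x
    have hx := h (Int.fract x) ⟨Int.fract_nonneg x, (Int.fract_lt_one x).le⟩
    have hcont : ContinuousAt (fun y : ℝ => y - (⌊x⌋ : ℝ)) x := by fun_prop
    have hev : ∀ᶠ y in 𝓝 x, f (y - ⌊x⌋) = f (x - ⌊x⌋) := hcont.eventually hx
    refine hev.mono fun y hy => ?_
    rw [f.map_sub_int, f.map_sub_int] at hy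
    linarith
  have hl : IsLocallyConstant f := (IsLocallyConstant.iff_eventually_eq f).2 hall
  have := hl.apply_eq_of_preconnectedSpace (0 + 1) 0
  rw [f.map_add_one] at this
  linarith

/-- A continuous monotone degree one map has an orbit along which it is nowhere locally
constant. -/
theorem exists_forall_iterate_notMem_constSet (f : CircleDeg1Lift) (hf : Continuous f) :
    ∃ x, ∀ n, f^[n] x ∉ constSet f := by
  let A : ℕ → Set ℝ := fun n => {x | x ∈ Icc (0 : ℝ) 1 ∧ ∀ i < n, f^[i] x ∉ constSet f}
  have hcl : ∀ n, IsClosed (A n) := by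
    intro n
    have : A n = Icc 0 1 ∩ ⋂ i, ⋂ (_ : i < n), f^[i] ⁻¹' (constSet f)ᶜ := by
      ext x; simp [A]
    rw [this]
    exact isClosed_Icc.inter (isClosed_iInter fun i => isClosed_iInter fun _ =>
      (isOpen_constSet f).isClosed_compl.preimage (hf.iterate i))
  -- Each `A n` is nonempty because the n-th iterate, itself of degree one, is not flat at some
  -- point of [0, 1].
  obtain ⟨x, hx⟩ := IsCompact.nonempty_iInter_of_sequence_nonempty_isCompact_isClosed A
    (fun n x hx => ⟨hx.1, fun i hi => hx.2 i (by omega)⟩)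
    (fun n => by
      obtain ⟨x, hx, hx'⟩ := (f ^ n).exists_notMem_constSet
      rw [coe_pow] at hx'
      exact ⟨x, hx, fun i hi h => hx' (f.mem_constSet_iterate hf hi h)⟩)
    (isCompact_Icc.of_isClosed_subset (hcl 0) fun x hx => hx.1) hcl
  rw [mem_iInter] at hx
  exact ⟨x, fun n => (hx (n + 1)).2 n (by omega)⟩

/-- Right of a solution in a flat piece, the graph of g drops below y + m; it must meet that line
again by x₀ + 1. At the first return it comes from strictly below the line, so g is not flat there.
-/
theorem exists_map_eq_add_int_notMem_constSet (g : CircleDeg1Lift) (hg : Continuous g) {m : ℤ}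
    (h : g.translationNumber = m) : ∃ x, g x = x + m ∧ x ∉ constSet g := by
  obtain ⟨x₀, hx₀⟩ := (g.translationNumber_eq_int_iff hg).1 h
  by_cases hc : x₀ ∈ constSet g
  swap
  · exact ⟨x₀, hx₀, hc⟩
  obtain ⟨δ, hδ, hd⟩ := Metric.eventually_nhds_iff.1 hc
  set z := x₀ + min (δ / 2) 1 with hz
  have hmin : 0 < min (δ / 2) 1 := lt_min (by linarith) one_pos
  have hgz : g z < z + m := by
    rw [hd (y := z), hx₀]
    · linarith
    · rw [Real.dist_eq, hz, add_sub_cancel_left, abs_of_pos hmin]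
      linarith [min_le_left (δ / 2) 1]
  let S : Set ℝ := {y | z ≤ y ∧ y + m ≤ g y}
  have hScl : IsClosed S := isClosed_Ici.inter (isClosed_le (by fun_prop) hg)
  have hSne : S.Nonempty :=
    ⟨x₀ + 1, by linarith [min_le_right (δ / 2) 1], by rw [g.map_add_one, hx₀]; linarith⟩
  have hSb : BddBelow S := ⟨z, fun y hy => hy.1⟩
  obtain ⟨hw1, hw2⟩ := hScl.csInf_mem hSne hSb
  set w := sInf S with hw
  have hlt : ∀ y, z ≤ y → y < w → g y < y + m := fun y hy hyw => by
    by_contra! hcon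
    exact absurd (csInf_le hSb ⟨hy, hcon⟩) (not_le.2 hyw)
  have hzw : z < w := lt_of_le_of_ne hw1 fun h => by rw [← h] at hw2; linarith
  have hev : ∀ᶠ y in 𝓝[<] w, g y < y + m := by
    filter_upwards [Ioo_mem_nhdsLT hzw] with y hy using hlt y hy.1.le hy.2
  have hle : g w ≤ w + m := by
    refine le_of_tendsto_of_tendsto (f := g) (g := fun y => y + m) (b := 𝓝[<] w)
      hg.continuousWithinAt
      (by apply ContinuousWithinAt.tendsto (f := fun y : ℝ => y + m); fun_prop)
      (hev.mono fun y hy => hy.le)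
  have heq := le_antisymm hle hw2
  refine ⟨w, heq, fun hcw => ?_⟩
  obtain ⟨y, hy, hy', hyw⟩ := (hev.and ((hcw.filter_mono nhdsWithin_le_nhds).and
    (self_mem_nhdsWithin (s := Iio w)))).exists
  rw [hy', heq] at hy
  have : y < w := hyw
  linarith

/-- Periodic orbits along which the map is nowhere locally constant. -/
theorem exists_periodic_forall_iterate_notMem_constSet (f : CircleDeg1Lift) (hf : Continuous f)
    {q : ℚ} (h : f.translationNumber = q) :
    ∃ x, f^[q.den] x = x + q.num ∧ ∀ n, f^[n] x ∉ constSet f := by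
  have hden : (q.den : ℝ) ≠ 0 := by exact_mod_cast q.den_ne_zero
  obtain ⟨x, hx, hx'⟩ := (f ^ q.den).exists_map_eq_add_int_notMem_constSet
    (f.continuous_pow hf _) (m := q.num) (by
      rw [translationNumber_pow, h]
      exact_mod_cast q.den_mul_eq_num)
  rw [coe_pow] at hx hx'
  have hfix : ∀ k : ℕ, f^[q.den * k] x = x + (k * q.num : ℤ) := by
    intro k
    have := (f ^ q.den).iterate_eq_of_map_eq_add_int (x := x) (m := q.num)
      (by rw [coe_pow]; exact hx) k
    rw [coe_pow, ← Function.iterate_mul] at this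
    rw [this]; push_cast; ring
  refine ⟨x, hx, fun n hn => hx' ?_⟩
  -- Periodicity moves a flat point at time n, by an integer translation, to a time i below the
  -- period. The whole period iterate would then be flat at x.
  obtain ⟨i, k, hi, hn'⟩ : ∃ i k, i < q.den ∧ n = i + q.den * k :=
    ⟨n % q.den, n / q.den, Nat.mod_lt _ q.den_pos, (Nat.mod_add_div _ _).symm⟩
  refine f.mem_constSet_iterate hf hi ?_
  rw [hn', Function.iterate_add_apply, hfix, ← coe_pow, map_add_int, coe_pow] at hn
  have hcont : ContinuousAt (fun y : ℝ => y + ((k * q.num : ℤ) : ℝ)) (f^[i] x) := by fun_prop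
  have hev : ∀ᶠ y in 𝓝 (f^[i] x), f (y + ((k * q.num : ℤ) : ℝ)) =
    f (f^[i] x + ((k * q.num : ℤ) : ℝ)) := hcont.eventually hn
  refine hev.mono fun y hy => ?_
  rw [f.map_add_int, f.map_add_int] at hy
  linarith

end CircleDeg1Lift

/-- Existence of an increasing orbit with prescribed rotation number for a degree one map of the
real line. -/
theorem exists_twist_orbit_real {φ : ℝ → ℝ} (hc : Continuous φ)
    (h1 : ∀ x, φ (x + 1) = φ x + 1) {a b α : ℝ} (ha : HasRotationNumber (runInf φ) a)
    (hb : HasRotationNumber (runSup φ) b) (hα : α ∈ Icc a b) :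
    ∃ x, (∀ n, φ^[n] x ∉ constSet φ) ∧
      StrictMonoOn φ {t | ∃ (n : ℕ) (m : ℤ), t = φ^[n] x + m} ∧
      (∀ n, Tendsto (fun k : ℕ => (φ^[k] (φ^[n] x) - φ^[n] x) / k) atTop (𝓝 α)) ∧
      ∀ q : ℚ, α = q → φ^[q.den] x = x + q.num := by
  choose f hfc hf using exists_water_lift hc h1
  obtain ⟨M, hM0, hM⟩ := exists_water_eq_runSup hc h1
  -- This allows the intermediate value theorem in μ to select a water function of translation
  -- number α.
  have hcont : Continuous fun μ => (f μ).translationNumber := by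
    rw [Metric.continuous_iff]
    intro μ ε hε
    obtain ⟨η, hη, h⟩ := (f μ).exists_translationNumber_near (hfc μ) hε
    refine ⟨η, hη, fun μ' hμ' => h _ fun x => ?_⟩
    rw [hf, hf, abs_le]
    rw [Real.dist_eq] at hμ'
    have h2 := water_le_add hc h1 μ μ' x
    have h3 := water_le_add hc h1 μ' μ x
    rw [abs_sub_comm] at h2
    constructor <;> linarith
  have h0 : (f 0).translationNumber = a := by
    have : ⇑(f 0) = runInf φ := by rw [← water_zero hc h1]; exact funext (hf 0)
    have h2 := (f 0).hasRotationNumber 0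
    rw [this] at h2
    exact tendsto_nhds_unique h2 (ha 0)
  have hMb : (f M).translationNumber = b := by
    have : ⇑(f M) = runSup φ := by rw [← hM]; exact funext (hf M)
    have h2 := (f M).hasRotationNumber 0
    rw [this] at h2
    exact tendsto_nhds_unique h2 (hb 0)
  obtain ⟨μ, hμ, hμα⟩ := intermediate_value_Icc hM0 hcont.continuousOn
    (by rw [h0, hMb]; exact hα)
  simp only at hμα
  have hconst : ∀ x, x ∉ constSet (f μ) → f μ x = φ x ∧ x ∉ constSet φ := by
    intro x hx
    have : ⇑(f μ) = water φ μ := funext (hf μ)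
    rw [this] at hx ⊢
    exact eq_water_of_notMem_constSet hc h1 hμ.1 hx
  obtain ⟨x, hx, hper⟩ : ∃ x, (∀ n, (f μ)^[n] x ∉ constSet (f μ)) ∧
      ∀ q : ℚ, α = q → (f μ)^[q.den] x = x + q.num := by
    by_cases hq : ∃ q : ℚ, α = q
    · obtain ⟨q, hq⟩ := hq
      obtain ⟨x, hx, hx'⟩ := (f μ).exists_periodic_forall_iterate_notMem_constSet (hfc μ)
        (hμα.trans hq)
      refine ⟨x, hx', fun q' hq' => ?_⟩
      obtain rfl : q = q' := by exact_mod_cast hq.symm.trans hq'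
      exact hx
    · obtain ⟨x, hx⟩ := (f μ).exists_forall_iterate_notMem_constSet (hfc μ)
      exact ⟨x, hx, fun q hq' => absurd ⟨q, hq'⟩ hq⟩
  have hit : ∀ n, φ^[n] x = (f μ)^[n] x := by
    intro n
    induction n with
    | zero => rfl
    | succ n ih =>
      rw [Function.iterate_succ_apply', Function.iterate_succ_apply', ih, (hconst _ (hx n)).1]
  have hφint : ∀ y : ℝ, ∀ m : ℤ, φ (y + m) = φ y + m := by
    intro y m
    have hp : Function.Periodic (fun x => φ x - x) 1 := fun x => by simp only [h1]; ring
    have := hp.int_mul m y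
    simp only [mul_one] at this
    linarith
  have hval : ∀ (n : ℕ) (m : ℤ), φ (φ^[n] x + m) = f μ (φ^[n] x + m) := by
    intro n m
    rw [hφint, (f μ).map_add_int, hit, (hconst _ (hx n)).1]
  have hshift : ∀ (k : ℕ) (y : ℝ) (m : ℤ), (f μ)^[k] (y + m) = (f μ)^[k] y + m := by
    intro k y m
    rw [← CircleDeg1Lift.coe_pow, CircleDeg1Lift.map_add_int]
  -- A coincidence mod 1 between images at different times is a periodic point mod 1, so α is
  -- rational.
  have hrat : ∀ {n n' : ℕ} {m m' : ℤ}, n < n' →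
      f μ ((f μ)^[n] x) + m = f μ ((f μ)^[n'] x) + m' → ∃ q : ℚ, α = q := by
    intro n n' m m' hn heq
    obtain ⟨k, rfl⟩ := Nat.exists_eq_add_of_lt hn
    have h3 : ((f μ) ^ (k + 1)) ((f μ)^[n + 1] x) = (f μ)^[n + 1] x + (m - m' : ℤ) := by
      rw [CircleDeg1Lift.coe_pow, ← Function.iterate_add_apply,
        show k + 1 + (n + 1) = (n + k + 1) + 1 by omega, Function.iterate_succ_apply',
        Function.iterate_succ_apply' (f μ) n]
      push_cast
      linarith
    have h4 := (f μ).translationNumber_of_map_pow_eq_add_int h3 (by omega)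
    refine ⟨(m - m' : ℤ) / (k + 1 : ℕ), ?_⟩
    rw [← hμα, h4]
    push_cast
    ring
  refine ⟨x, fun n => ?_, ?_, ?_, fun q hq => ?_⟩
  · rw [hit]; exact (hconst _ (hx n)).2
  · rintro _ ⟨n, m, rfl⟩ _ ⟨n', m', rfl⟩ hlt
    rw [hval, hval]
    refine lt_of_le_of_ne ((f μ).monotone hlt.le) fun heq => hlt.ne ?_
    rw [hit, hit] at heq ⊢
    by_cases hq : ∃ q : ℚ, α = q
    · obtain ⟨q, hq⟩ := hq
      have hp : ∀ (n : ℕ) (m : ℤ), (f μ)^[q.den] ((f μ)^[n] x + m) =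
          (f μ)^[n] x + m + q.num := by
        intro n m
        rw [hshift, ← Function.iterate_add_apply, add_comm q.den, Function.iterate_add_apply,
          hper q hq, hshift]
        ring
      -- Applying the rest of the period to equal images recovers the two points, both shifted by
      -- `q.num`.
      have h2 := congrArg (f μ)^[q.den - 1] heq
      rw [← Function.iterate_succ_apply, ← Function.iterate_succ_apply,
        show (q.den - 1).succ = q.den from Nat.sub_add_cancel q.den_pos, hp, hp] at h2
      linarith
    · have hnn : n = n' := by
        rw [(f μ).map_add_int, (f μ).map_add_int] at heq
        rcases lt_trichotomy n n' with hn | hn | hn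
        · exact absurd (hrat hn heq) hq
        · exact hn
        · exact absurd (hrat hn heq.symm) hq
      subst hnn
      rw [(f μ).map_add_int, (f μ).map_add_int] at heq
      linarith
  · intro n
    have := (f μ).hasRotationNumber ((f μ)^[n] x)
    rw [hμα] at this
    refine this.congr fun k => ?_
    rw [← Function.iterate_add_apply, ← Function.iterate_add_apply, hit, hit]
  · rw [hit]; exact hper q hq

/-! ### Real functions with closed graph -/

section ClosedGraph

variable {g : ℝ → ℝ}

/-- Near s the values lie in [-N, N]. The part of this interval outside a neighbourhood of g s is
compact, so its closed preimage misses a neighbourhood of s. -/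
theorem continuousAt_of_isClosed_preimage (H : ∀ S, IsCompact S → IsClosed (g ⁻¹' S)) {s N : ℝ}
    (hs : ∀ᶠ y in 𝓝 s, |g y| ≤ N) : ContinuousAt g s := by
  refine tendsto_nhds.2 fun U hU hsU => ?_
  have hc : IsCompact (Icc (-N) N \ U) := isCompact_Icc.diff hU
  have hn : (g ⁻¹' (Icc (-N) N \ U))ᶜ ∈ 𝓝 s :=
    (H _ hc).isOpen_compl.mem_nhds fun h => h.2 hsU
  filter_upwards [hs, hn] with y hy hy'
  by_contra hyU
  exact hy' ⟨abs_le.1 hy, hyU⟩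

theorem eventually_ne_of_isClosed_preimage (H : ∀ S, IsCompact S → IsClosed (g ⁻¹' S)) {s : ℝ}
    {S : Set ℝ} (hS : IsCompact S) (hs : g s ∉ S) : ∀ᶠ y in 𝓝 s, g y ∉ S :=
  (H S hS).isOpen_compl.mem_nhds hs

/-- A function with closed graph which is continuous to the right of `p` is continuous from the
right at `p` or tends to infinity there. -/
theorem continuousWithinAt_or_tendsto (H : ∀ S, IsCompact S → IsClosed (g ⁻¹' S)) {p q : ℝ}
    (hpq : p < q) (hg : ContinuousOn g (Ioc p q)) :
    ContinuousWithinAt g (Ioi p) p ∨ Tendsto g (𝓝[>] p) atTop ∨ Tendsto g (𝓝[>] p) atBot := by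
  -- Near p the levels g p ± 1 are avoided. The image of a short interval right of p is connected,
  -- so it lies below, between or above them: the three cases of the conclusion.
  have h2 := eventually_ne_of_isClosed_preimage H (s := p) (S := {g p - 1, g p + 1})
    (by simp) (by
      rintro (h | h)
      · linarith
      · have : g p = g p + 1 := h
        linarith)
  obtain ⟨δ, hδ, hd⟩ := Metric.eventually_nhds_iff.1 h2
  have hq' : p < min q (p + δ) := lt_min hpq (by linarith)
  set q' := min q (p + δ) with hq'def
  have hne : ∀ s ∈ Ioo p q', g s ∉ ({g p - 1, g p + 1} : Set ℝ) := fun s hs => hd (by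
    rw [Real.dist_eq, abs_of_pos (by linarith [hs.1])]
    linarith [hs.2, min_le_right q (p + δ)])
  have hc : ContinuousOn g (Ioo p q') := hg.mono fun s hs =>
    ⟨hs.1, hs.2.le.trans (min_le_left _ _)⟩
  have himg : (g '' Ioo p q').OrdConnected :=
    (isPreconnected_Ioo.image _ hc).ordConnected
  have hnot : ∀ v ∈ ({g p - 1, g p + 1} : Set ℝ), v ∉ g '' Ioo p q' := by
    rintro v hv ⟨s, hs, rfl⟩
    exact hne s hs hv
  have hm1 := hnot (g p - 1) (by simp)
  have hm2 := hnot (g p + 1) (by simp)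
  have hmem : Ioo p q' ∈ 𝓝[>] p := Ioo_mem_nhdsGT hq'
  obtain ⟨s₀, hs₀⟩ := nonempty_Ioo.2 hq'
  have hs₀' : g s₀ ∈ g '' Ioo p q' := ⟨s₀, hs₀, rfl⟩
  have key : ∀ v ∉ g '' Ioo p q', (∀ s ∈ Ioo p q', g s < v) ∨ (∀ s ∈ Ioo p q', v < g s) := by
    intro v hv
    by_contra! hcon
    obtain ⟨⟨s, hs, h⟩, ⟨s', hs', h'⟩⟩ := hcon
    exact hv (himg.out ⟨s', hs', rfl⟩ ⟨s, hs, rfl⟩ ⟨h', h⟩)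
  have hesc : ∀ S, IsCompact S → g p ∉ S → ∀ᶠ s in 𝓝[>] p, g s ∉ S := fun S hS hp =>
    (eventually_ne_of_isClosed_preimage H hS hp).filter_mono nhdsWithin_le_nhds
  rcases key _ hm2 with hlt | hgt
  · rcases key _ hm1 with hlt' | hgt'
    · right; right
      refine tendsto_atBot.2 fun K => ?_
      filter_upwards [hmem, hesc (Icc K (g p - 1)) isCompact_Icc fun h => by linarith [h.2]]
        with s hs hs'
      by_contra! hcon
      exact hs' ⟨hcon.le, (hlt' s hs).le⟩
    · left
      refine tendsto_nhds.2 fun U hU hpU => ?_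
      filter_upwards [hmem, hesc (Icc (g p - 1) (g p + 1) \ U) (isCompact_Icc.diff hU)
        fun h => h.2 hpU] with s hs hs'
      by_contra hcon
      exact hs' ⟨⟨(hgt' s hs).le, (hlt s hs).le⟩, hcon⟩
  · right; left
    refine tendsto_atTop.2 fun K => ?_
    filter_upwards [hmem, hesc (Icc (g p + 1) K) isCompact_Icc fun h => by linarith [h.1]]
      with s hs hs'
    by_contra! hcon
    exact hs' ⟨(hgt s hs).le, hcon.le⟩

/-- A bound on E spreads to its right. If |g s| exceeded N + 1, then g would be continuous from the
last point p of E before s up to s. It would thus cross the level N + 1, which is avoided near e. -/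
theorem eventually_right_bounded (H : ∀ S, IsCompact S → IsClosed (g ⁻¹' S))
    (H' : ∀ p q, p < q → ContinuousOn g (Ioc p q) → ContinuousWithinAt g (Ioi p) p)
    {E : Set ℝ} (hE : IsClosed E) (hcE : ∀ s ∉ E, ContinuousAt g s) {e δ N : ℝ} (he : e ∈ E)
    (hδ : 0 < δ) (hN : ∀ s ∈ E, |s - e| < δ → |g s| ≤ N) :
    ∀ᶠ s in 𝓝[>] e, |g s| ≤ N + 1 := by
  have heN : |g e| ≤ N := hN e he (by simpa)
  have hN0 : 0 ≤ N := (abs_nonneg _).trans heN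
  have h2 := eventually_ne_of_isClosed_preimage H (s := e) (S := {-(N + 1), N + 1})
    (by simp) (by
      rw [abs_le] at heN
      rintro (h | h)
      · linarith
      · have : g e = N + 1 := h
        linarith)
  obtain ⟨δ', hδ', hd⟩ := Metric.eventually_nhds_iff.1 h2
  have hlt : e < min (e + δ) (e + δ') := lt_min (by linarith) (by linarith)
  filter_upwards [Ioo_mem_nhdsGT hlt] with s hs
  have hs1 := hs.2.trans_le (min_le_left _ _)
  have hs2 := hs.2.trans_le (min_le_right _ _)
  by_contra! hcon
  have hsE : s ∉ E := fun h => by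
    have := hN s h (by rw [abs_of_pos (by linarith [hs.1])]; linarith)
    linarith
  have hKc : IsCompact (E ∩ Icc e s) := isCompact_Icc.inter_left hE
  have hKne : (E ∩ Icc e s).Nonempty := ⟨e, he, le_rfl, hs.1.le⟩
  obtain ⟨hpE, hep, hps⟩ := hKc.sSup_mem hKne
  have hlast : ∀ y ∈ Ioc (sSup (E ∩ Icc e s)) s, y ∉ E := fun y hy hyE =>
    absurd (le_csSup hKc.bddAbove ⟨hyE, hep.trans hy.1.le, hy.2⟩) (not_le.2 hy.1)
  set p := sSup (E ∩ Icc e s) with hp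
  have hps' : p < s := lt_of_le_of_ne hps fun h => hsE (h ▸ hpE)
  have hc1 : ContinuousOn g (Ioc p s) := fun y hy => (hcE y (hlast y hy)).continuousWithinAt
  have hc2 : ContinuousOn g (Icc p s) := by
    intro y hy
    rcases eq_or_lt_of_le hy.1 with h | h
    · rw [← h]
      have := (H' p s hps' hc1)
      exact (continuousWithinAt_Ioi_iff_Ici.1 this).mono Icc_subset_Ici_self
    · exact (hcE y (hlast y ⟨h, hy.2⟩)).continuousWithinAt
  have hgp : |g p| ≤ N := hN p hpE (by rw [abs_of_nonneg (by linarith)]; linarith)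
  obtain ⟨y, hy, hgy⟩ := intermediate_value_Icc hps hc2.abs
    (show N + 1 ∈ Icc |g p| |g s| from ⟨by linarith, hcon.le⟩)
  refine hd (y := y) (by
    rw [Real.dist_eq, abs_of_nonneg (by linarith [hy.1])]; linarith [hy.2]) ?_
  rcases (abs_eq (by linarith)).1 hgy with h | h
  · exact Or.inr h
  · exact Or.inl h

/-- A real function with closed graph and without one-sided explosions is continuous. -/
theorem continuous_of_isClosed_preimage (H : ∀ S, IsCompact S → IsClosed (g ⁻¹' S))
    (H₁ : ∀ p q, p < q → ContinuousOn g (Ioc p q) → ContinuousWithinAt g (Ioi p) p)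
    (H₂ : ∀ p q, p < q → ContinuousOn (fun s => g (-s)) (Ioc p q) →
      ContinuousWithinAt (fun s => g (-s)) (Ioi p) p) : Continuous g := by
  -- Local unboundedness is the only obstruction to continuity. If this closed set is nonempty,
  -- Baire's theorem bounds g on a relatively open piece of it, and the bound then spreads to a full
  -- neighbourhood.
  set E : Set ℝ := {s | ¬ ∃ N, ∀ᶠ y in 𝓝 s, |g y| ≤ N} with hEdef
  have hcE : ∀ s ∉ E, ContinuousAt g s := fun s hs => by
    obtain ⟨N, hN⟩ := not_not.1 hs
    exact continuousAt_of_isClosed_preimage H hN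
  have hE : IsClosed E := by
    rw [← isOpen_compl_iff, isOpen_iff_eventually]
    intro s hs
    obtain ⟨N, hN⟩ := not_not.1 hs
    exact (eventually_eventually_nhds.2 hN).mono fun y hy => not_not.2 ⟨N, hy⟩
  rcases E.eq_empty_or_nonempty with h0 | hne
  · exact continuous_iff_continuousAt.2 fun s => hcE s (by simp [h0])
  exfalso
  have : Nonempty E := hne.to_subtype
  have : CompleteSpace E := hE.completeSpace_coe
  obtain ⟨N, ⟨e, he⟩, hint⟩ := nonempty_interior_of_iUnion_of_closed
    (f := fun N : ℕ => {s : E | g s ∈ Icc (-(N : ℝ)) N})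
    (fun N => (H _ isCompact_Icc).preimage continuous_subtype_val)
    (by
      ext s
      simp only [mem_iUnion, mem_univ, iff_true]
      obtain ⟨N, hN⟩ := exists_nat_ge |g s|
      exact ⟨N, abs_le.1 hN⟩)
  rw [mem_interior_iff_mem_nhds, Metric.mem_nhds_iff] at hint
  obtain ⟨δ, hδ, hd⟩ := hint
  have hN : ∀ s ∈ E, |s - e| < δ → |g s| ≤ N := fun s hs hse =>
    abs_le.2 (hd (show (⟨s, hs⟩ : E) ∈ Metric.ball ⟨e, he⟩ δ from hse))
  have hR := eventually_right_bounded H H₁ hE hcE he hδ hN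
  have hL := eventually_right_bounded (g := fun s => g (-s)) (E := -E) (e := -e) (N := N)
    (fun S hS => (H S hS).preimage continuous_neg) H₂ hE.neg
    (fun s hs => ContinuousAt.comp (f := fun s : ℝ => -s) (g := g) (hcE (-s) hs)
      continuous_neg.continuousAt)
    (by simpa using he) hδ
    (fun s hs hse => hN (-s) hs (by rwa [← abs_neg, neg_sub, sub_neg_eq_add, add_comm,
      ← sub_neg_eq_add]))
  have hL' : ∀ᶠ s in 𝓝[<] e, |g s| ≤ N + 1 := by
    have := (tendsto_neg_nhdsLT (a := e)).eventually hL
    simpa using this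
  refine he ⟨N + 1, ?_⟩
  rw [← nhdsNE_sup_pure, ← nhdsLT_sup_nhdsGT, eventually_sup, eventually_sup]
  exact ⟨⟨hL', hR⟩, by simpa using (hN e he (by simpa)).trans (by linarith)⟩

end ClosedGraph

namespace LiftedSpace

variable {T : Type*} [MetricSpace T] (L : LiftedSpace T)

/-! ### The natural retraction -/

theorem h_injective : Function.Injective L.h := L.isEmbedding_h.injective

@[simp] theorem r_h (t : ℝ) : L.r (L.h t) = t := by
  have hx : L.h t ∈ range L.h := ⟨t, rfl⟩
  rw [r, dif_pos hx]
  exact L.h_injective hx.choose_spec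

theorem closure_inter_range {x : T} (hx : x ∉ range L.h) :
    closure (connectedComponentIn (range L.h)ᶜ x) ∩ range L.h = {L.h (L.r x)} := by
  rw [r, dif_neg hx]
  exact (L.closure_inter x hx).choose_spec

theorem eq_h_of_mem_range {x : T} (hx : x ∈ range L.h) : x = L.h (L.r x) := by
  obtain ⟨t, rfl⟩ := hx
  rw [r_h]

theorem h_r_mem_closure {x : T} (hx : x ∉ range L.h) :
    L.h (L.r x) ∈ closure (connectedComponentIn (range L.h)ᶜ x) := by
  have : L.h (L.r x) ∈ closure (connectedComponentIn (range L.h)ᶜ x) ∩ range L.h := by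
    rw [L.closure_inter_range hx]; rfl
  exact this.1

/-- Adjoining a limit point keeps a connected set connected, so components are closed relative to
the complement of the line. -/
theorem mem_component_of_mem_closure {x y : T} (hx : x ∉ range L.h)
    (hy : y ∈ closure (connectedComponentIn (range L.h)ᶜ x)) (hy' : y ∉ range L.h) :
    y ∈ connectedComponentIn (range L.h)ᶜ x := by
  have hpre : IsPreconnected (insert y (connectedComponentIn (range L.h)ᶜ x)) :=
    isPreconnected_connectedComponentIn.subset_closure (subset_insert _ _)
      (insert_subset hy subset_closure)
  refine hpre.subset_connectedComponentIn
    (mem_insert_of_mem _ (mem_connectedComponentIn hx)) ?_ (mem_insert _ _)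
  exact insert_subset hy' (connectedComponentIn_subset _ _)

theorem r_eq_of_mem_closure {x y : T} (hx : x ∉ range L.h)
    (hy : y ∈ closure (connectedComponentIn (range L.h)ᶜ x)) : L.r y = L.r x := by
  by_cases hy' : y ∈ range L.h
  · have : y ∈ closure (connectedComponentIn (range L.h)ᶜ x) ∩ range L.h := ⟨hy, hy'⟩
    rw [L.closure_inter_range hx] at this
    rw [mem_singleton_iff.1 this, r_h]
  · have h1 := L.closure_inter_range hx
    rw [connectedComponentIn_eq (L.mem_component_of_mem_closure hx hy hy'),
      L.closure_inter_range hy'] at h1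
    exact L.h_injective (singleton_injective h1)

theorem image_τ_range : L.τ '' range L.h = range L.h := by
  ext x
  constructor
  · rintro ⟨_, ⟨t, rfl⟩, rfl⟩
    exact ⟨t + 1, (L.τ_h t).symm⟩
  · rintro ⟨t, rfl⟩
    exact ⟨L.h (t - 1), ⟨_, rfl⟩, by rw [L.τ_h, sub_add_cancel]⟩

theorem τ_mem_range_iff {x : T} : L.τ x ∈ range L.h ↔ x ∈ range L.h := by
  conv_lhs => rw [← L.image_τ_range]
  exact L.τ.injective.mem_set_image

theorem image_τ_component {x : T} (hx : x ∉ range L.h) :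
    L.τ '' connectedComponentIn (range L.h)ᶜ x = connectedComponentIn (range L.h)ᶜ (L.τ x) := by
  rw [L.τ.image_connectedComponentIn hx, image_compl_eq L.τ.bijective, L.image_τ_range]

@[simp] theorem r_τ (x : T) : L.r (L.τ x) = L.r x + 1 := by
  by_cases hx : x ∈ range L.h
  · obtain ⟨t, rfl⟩ := hx
    rw [L.τ_h, r_h, r_h]
  · have hx' : L.τ x ∉ range L.h := fun h => hx (L.τ_mem_range_iff.1 h)
    have h1 := L.h_r_mem_closure hx
    have h2 : L.τ (L.h (L.r x)) ∈ closure (connectedComponentIn (range L.h)ᶜ (L.τ x)) := by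
      rw [← L.image_τ_component hx, ← L.τ.image_closure]
      exact mem_image_of_mem _ h1
    rw [L.τ_h] at h2
    have h3 := L.r_eq_of_mem_closure hx' h2
    rw [r_h] at h3
    exact h3.symm

theorem τ_zpow_h (m : ℤ) (t : ℝ) : (L.τ ^ m) (L.h t) = L.h (t + m) := by
  induction m using Int.induction_on generalizing t with
  | zero => simp
  | succ i ih =>
    rw [zpow_add_one, Homeomorph.mul_apply, L.τ_h, ih]
    congr 1; push_cast; ring
  | pred i ih =>
    rw [zpow_sub_one, Homeomorph.mul_apply]
    have : L.τ⁻¹ (L.h t) = L.h (t - 1) := by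
      apply L.τ.injective
      rw [← Homeomorph.mul_apply, mul_inv_cancel, Homeomorph.one_apply, L.τ_h, sub_add_cancel]
    rw [this, ih]
    congr 1; push_cast; ring

theorem r_τ_zpow (m : ℤ) (x : T) : L.r ((L.τ ^ m) x) = L.r x + m := by
  induction m using Int.induction_on generalizing x with
  | zero => simp
  | succ i ih =>
    rw [zpow_add_one, Homeomorph.mul_apply, ih, r_τ]
    push_cast; ring
  | pred i ih =>
    rw [zpow_sub_one, Homeomorph.mul_apply, ih]
    have : L.r (L.τ (L.τ⁻¹ x)) = L.r (L.τ⁻¹ x) + 1 := L.r_τ _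
    rw [← Homeomorph.mul_apply, mul_inv_cancel, Homeomorph.one_apply] at this
    push_cast; linarith

/-- The connected components of the complement of the line which are attached to it at a point
of `S`. -/
def componentsOver (S : Set ℝ) : Set (Set T) :=
  {C | ∃ x ∉ range L.h, C = connectedComponentIn (range L.h)ᶜ x ∧ L.r x ∈ S}

theorem finite_componentsOver_Icc (k : ℤ) : (L.componentsOver (Icc (k : ℝ) (k + 1))).Finite := by
  -- Translation by τ carries the finiteness assumed over [0, 1] to every unit interval.
  have himg : ∀ k : ℤ, L.componentsOver (Icc ((k + 1 : ℤ) : ℝ) ((k + 1 : ℤ) + 1)) =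
      image L.τ '' L.componentsOver (Icc (k : ℝ) (k + 1)) := by
    intro k
    ext C
    constructor
    · rintro ⟨x, hx, rfl, hxk⟩
      obtain ⟨y, rfl⟩ := L.τ.surjective x
      rw [L.τ_mem_range_iff] at hx
      refine ⟨_, ⟨y, hx, rfl, ?_⟩, L.image_τ_component hx⟩
      rw [r_τ] at hxk
      push_cast at hxk
      exact ⟨by linarith [hxk.1], by linarith [hxk.2]⟩
    · rintro ⟨_, ⟨y, hy, rfl, hyk⟩, rfl⟩
      refine ⟨L.τ y, fun h => hy (L.τ_mem_range_iff.1 h), L.image_τ_component hy, ?_⟩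
      rw [r_τ]
      push_cast
      exact ⟨by linarith [hyk.1], by linarith [hyk.2]⟩
  induction k using Int.induction_on with
  | zero =>
    refine L.finite_components.subset ?_
    rintro C ⟨x, hx, rfl, hxS⟩
    refine ⟨⟨x, hx, rfl⟩, L.h (L.r x), L.h_r_mem_closure hx, _, ?_, rfl⟩
    simpa using hxS
  | succ i ih =>
    rw [himg]
    exact ih.image _
  | pred i ih =>
    have h := himg (-(i : ℤ) - 1)
    rw [sub_add_cancel] at h
    rw [h] at ih
    exact ih.of_finite_image (image_injective.2 L.τ.injective).injOn

theorem finite_componentsOver {S : Set ℝ} (hS : Bornology.IsBounded S) :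
    (L.componentsOver S).Finite := by
  obtain ⟨R, hR⟩ := hS.subset_closedBall 0
  rw [Real.closedBall_eq_Icc] at hR
  refine ((finite_Icc ⌊0 - R⌋ ⌊0 + R⌋).biUnion fun k _ => L.finite_componentsOver_Icc k).subset ?_
  rintro C ⟨x, hx, rfl, hxS⟩
  have h := hR hxS
  refine mem_biUnion (x := ⌊L.r x⌋) ⟨Int.floor_mono h.1, Int.floor_mono h.2⟩
    ⟨x, hx, rfl, Int.floor_le _, (Int.lt_floor_add_one _).le⟩

/-- The preimage is h(S) together with the closures of finitely many components. This is the closed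
graph property used in place of continuity of r on T. -/
theorem isClosed_preimage_r {S : Set ℝ} (hS : IsCompact S) : IsClosed (L.r ⁻¹' S) := by
  have : L.r ⁻¹' S = L.h '' S ∪ ⋃ C ∈ L.componentsOver S, closure C := by
    ext x
    constructor
    · intro hx
      by_cases hxr : x ∈ range L.h
      · exact Or.inl ⟨L.r x, hx, (L.eq_h_of_mem_range hxr).symm⟩
      · exact Or.inr (mem_biUnion ⟨x, hxr, rfl, hx⟩
          (subset_closure (mem_connectedComponentIn hxr)))
    · rintro (⟨t, ht, rfl⟩ | hx)
      · simpa using ht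
      · obtain ⟨C, ⟨y, hy, rfl, hyS⟩, hxC⟩ := mem_iUnion₂.1 hx
        rw [mem_preimage, L.r_eq_of_mem_closure hy hxC]
        exact hyS
  rw [this]
  exact (hS.image L.isEmbedding_h.continuous).isClosed.union
    ((L.finite_componentsOver hS.isBounded).isClosed_biUnion fun _ _ => isClosed_closure)

/-- Some class of points modulo one has no components attached to it. -/
theorem exists_unattached : ∃ t : ℝ, ∀ (m : ℤ) (x : T), L.r x = t + m → x = L.h (t + m) := by
  have hfin : {t : ℝ | ({t} : Set ℝ) ∈ image L.r '' L.componentsOver (Icc 0 1)}.Finite :=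
    ((L.finite_componentsOver (Metric.isBounded_Icc 0 1)).image _).preimage
      singleton_injective.injOn
  obtain ⟨t, ht, htn⟩ := (Icc_infinite (zero_lt_one (α := ℝ))).exists_notMem_finite hfin
  have h0 : ∀ x, L.r x = t → x ∈ range L.h := by
    intro x hx
    by_contra hxr
    refine htn ⟨_, ⟨x, hxr, rfl, by rwa [hx]⟩, ?_⟩
    refine subset_antisymm ?_ ?_
    · rintro _ ⟨y, hy, rfl⟩
      rw [L.r_eq_of_mem_closure hxr (subset_closure hy), hx]; rfl
    · rintro _ rfl
      exact ⟨x, mem_connectedComponentIn hxr, hx⟩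
  refine ⟨t, fun m x hx => ?_⟩
  have h1 : L.r ((L.τ ^ (-m)) x) = t := by rw [r_τ_zpow, hx]; push_cast; ring
  have h2 := L.eq_h_of_mem_range (h0 _ h1)
  rw [h1] at h2
  rw [← L.τ_zpow_h, ← h2, ← Homeomorph.mul_apply, ← zpow_add, add_neg_cancel, zpow_zero,
    Homeomorph.one_apply]

/-- A path cannot run off to infinity along the line in finite time. -/
theorem not_tendsto_mul_r_atTop {c : ℝ → T} (hc : Continuous c) {p q : ℝ} (hpq : p < q)
    (hg : ContinuousOn (fun s => L.r (c s)) (Ioc p q)) {σ : ℤ} (hσ : σ * σ = 1) :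
    ¬ Tendsto (fun s => (σ : ℝ) * L.r (c s)) (𝓝[>] p) atTop := by
  intro hT
  have hσ' : (σ : ℝ) * σ = 1 := by exact_mod_cast hσ
  obtain ⟨t, ht⟩ := L.exists_unattached
  -- Arbitrarily close to p the path crosses two consecutive translates of the unattached point.
  -- There r determines the point of T, so one crossing is the image of the other under `L.τ ^ σ`.
  have key : ∀ n : ℕ, ∃ s s', s ∈ Ioc p (p + 1 / (n + 1 : ℝ)) ∧
      s' ∈ Ioc p (p + 1 / (n + 1 : ℝ)) ∧ c s' = (L.τ ^ σ) (c s) := by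
    intro n
    have hpos : (0 : ℝ) < 1 / (n + 1 : ℝ) := by positivity
    set q' := min q (p + 1 / (n + 1 : ℝ))
    have hq' : p < q' := lt_min hpq (by linarith)
    have hval : ∀ v, (σ : ℝ) * L.r (c q') ≤ v → ∃ s ∈ Ioc p q', (σ : ℝ) * L.r (c s) = v := by
      intro v hv
      obtain ⟨u, hu, hup, huq⟩ := ((hT.eventually (eventually_ge_atTop v)).and
        (Ioo_mem_nhdsGT hq')).exists
      obtain ⟨s, hs, hsv⟩ := intermediate_value_Icc' huq.le
        (f := fun s => (σ : ℝ) * L.r (c s)) (continuousOn_const.mul (hg.mono fun y hy =>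
          ⟨hup.trans_le hy.1, hy.2.trans (min_le_left _ _)⟩)) ⟨hv, hu⟩
      exact ⟨s, ⟨hup.trans_le hs.1, hs.2⟩, hsv⟩
    have hpt : ∀ (k : ℤ) s, (σ : ℝ) * L.r (c s) = σ * t + k → c s = L.h (t + (σ * k : ℤ)) := by
      intro k s hs
      refine ht _ _ ?_
      push_cast
      calc L.r (c s) = σ * σ * L.r (c s) := by rw [hσ', one_mul]
        _ = σ * (σ * t + k) := by rw [← hs]; ring
        _ = σ * σ * t + σ * k := by ring
        _ = t + σ * k := by rw [hσ', one_mul]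
    obtain ⟨k, hk⟩ := exists_int_gt ((σ : ℝ) * L.r (c q') - σ * t)
    obtain ⟨s, hs, hsv⟩ := hval (σ * t + k) (by linarith)
    obtain ⟨s', hs', hsv'⟩ := hval (σ * t + (k + 1 : ℤ)) (by push_cast; linarith)
    refine ⟨s, s', ⟨hs.1, hs.2.trans (min_le_right _ _)⟩,
      ⟨hs'.1, hs'.2.trans (min_le_right _ _)⟩, ?_⟩
    rw [hpt _ _ hsv, hpt _ _ hsv', L.τ_zpow_h]
    congr 1
    push_cast
    ring
  choose s s' hs hs' hss using key
  have hlim : Tendsto (fun n : ℕ => p + 1 / (n + 1 : ℝ)) atTop (𝓝 p) := by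
    simpa using tendsto_const_nhds.add (tendsto_one_div_add_atTop_nhds_zero_nat (𝕜 := ℝ))
  have hsl : Tendsto s atTop (𝓝 p) := tendsto_of_tendsto_of_tendsto_of_le_of_le
    tendsto_const_nhds hlim (fun n => (hs n).1.le) fun n => (hs n).2
  have hsl' : Tendsto s' atTop (𝓝 p) := tendsto_of_tendsto_of_tendsto_of_le_of_le
    tendsto_const_nhds hlim (fun n => (hs' n).1.le) fun n => (hs' n).2
  have h1 : Tendsto (fun n => c (s' n)) atTop (𝓝 (c p)) := (hc.tendsto p).comp hsl'
  have h2 : Tendsto (fun n => (L.τ ^ σ) (c (s n))) atTop (𝓝 ((L.τ ^ σ) (c p))) :=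
    ((L.τ ^ σ).continuous.tendsto _).comp ((hc.tendsto p).comp hsl)
  simp only [hss] at h1
  -- In the limit c p is fixed by `L.τ ^ σ`, although that map changes r by σ ≠ 0.
  have h3 := congrArg L.r (tendsto_nhds_unique h1 h2)
  rw [r_τ_zpow] at h3
  have : (σ : ℝ) = 0 := by linarith
  rw [this] at hσ'
  norm_num at hσ'

theorem continuousWithinAt_r_comp {c : ℝ → T} (hc : Continuous c) {p q : ℝ} (hpq : p < q)
    (hg : ContinuousOn (fun s => L.r (c s)) (Ioc p q)) :
    ContinuousWithinAt (fun s => L.r (c s)) (Ioi p) p := by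
  rcases continuousWithinAt_or_tendsto
    (fun S hS => (L.isClosed_preimage_r hS).preimage hc) hpq hg with h | h | h
  · exact h
  · exact absurd (by simpa using h) (L.not_tendsto_mul_r_atTop hc hpq hg (σ := 1) rfl)
  · exact absurd (by simpa using h) (L.not_tendsto_mul_r_atTop hc hpq hg (σ := -1) rfl)

/-- The retraction is continuous along paths. -/
theorem continuous_r_comp {c : ℝ → T} (hc : Continuous c) : Continuous fun s => L.r (c s) :=
  continuous_of_isClosed_preimage (fun _ hS => (L.isClosed_preimage_r hS).preimage hc)
    (fun _ _ hpq hg => L.continuousWithinAt_r_comp hc hpq hg)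
    fun _ _ hpq hg => L.continuousWithinAt_r_comp (hc.comp continuous_neg) hpq hg

/-- A path which leaves the line stays in a component for some time. -/
theorem mem_constSet_of_notMem_range {c : ℝ → T} (hc : Continuous c) {s : ℝ}
    (hs : c s ∉ range L.h) : s ∈ constSet fun u => L.r (c u) := by
  set t := L.r (c s) with ht
  set C := connectedComponentIn (range L.h)ᶜ (c s) with hC
  -- Z holds every point over [t - 1, t + 1] outside C. It is closed and misses c s, so nearby
  -- points of the path remain in C.
  let Z : Set T := L.h '' Icc (t - 1) (t + 1) ∪
    ⋃ D ∈ L.componentsOver (Icc (t - 1) (t + 1)) \ {C}, closure D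
  have hZ : IsClosed Z := (isCompact_Icc.image L.isEmbedding_h.continuous).isClosed.union
    (((L.finite_componentsOver (Metric.isBounded_Icc _ _)).subset sdiff_subset).isClosed_biUnion
      fun _ _ => isClosed_closure)
  have hsZ : c s ∉ Z := by
    rintro (⟨u, -, hu⟩ | h)
    · exact hs ⟨u, hu⟩
    · obtain ⟨D, ⟨⟨y, hy, rfl, -⟩, hD⟩, hsD⟩ := mem_iUnion₂.1 h
      exact hD (connectedComponentIn_eq (L.mem_component_of_mem_closure hy hsD hs))
  have h1 : ∀ᶠ u in 𝓝 s, c u ∉ Z := hc.continuousAt.eventually (hZ.isOpen_compl.mem_nhds hsZ)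
  have h2 : ∀ᶠ u in 𝓝 s, L.r (c u) ∈ Icc (t - 1) (t + 1) :=
    (L.continuous_r_comp hc).continuousAt.eventually
      (Icc_mem_nhds (by simp only [← ht]; linarith) (by simp only [← ht]; linarith))
  filter_upwards [h1, h2] with u hu1 hu2
  by_cases hur : c u ∈ range L.h
  · exact absurd (Or.inl ⟨_, hu2, (L.eq_h_of_mem_range hur).symm⟩) hu1
  · by_cases huC : connectedComponentIn (range L.h)ᶜ (c u) = C
    · refine L.r_eq_of_mem_closure hs (subset_closure ?_)
      rw [← hC, ← huC]
      exact mem_connectedComponentIn hur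
    · have hmem : connectedComponentIn (range L.h)ᶜ (c u) ∈
          L.componentsOver (Icc (t - 1) (t + 1)) \ {C} := ⟨⟨c u, hur, rfl, hu2⟩, huC⟩
      exact absurd (Or.inr (mem_biUnion hmem
        (subset_closure (mem_connectedComponentIn (F := (range L.h)ᶜ) hur)))) hu1

end LiftedSpace

namespace LiftedSpace

variable {T : Type*} [MetricSpace T] (L : LiftedSpace T)

/-! ### The maps `F_l` and `F_u` -/

section Bounds

variable {L} {G : T → T} {B : ℝ}

/-- The displacement bound makes the set bounded above, so `sSup` is a true supremum and not its
default value. -/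
theorem le_upper (hB : ∀ y, |L.r (G y) - L.r y| ≤ B) {x : ℝ} {y : T} (hy : L.r y ≤ x) :
    L.r (G y) ≤ L.upper G x := by
  refine le_csSup ⟨x + B, ?_⟩ ⟨y, hy, rfl⟩
  rintro _ ⟨z, hz, rfl⟩
  linarith [(abs_le.1 (hB z)).2]

theorem upper_le {x v : ℝ} (h : ∀ y, L.r y ≤ x → L.r (G y) ≤ v) : L.upper G x ≤ v :=
  csSup_le ⟨_, L.h x, by simp, rfl⟩ (by rintro _ ⟨y, hy, rfl⟩; exact h y hy)

theorem lower_le (hB : ∀ y, |L.r (G y) - L.r y| ≤ B) {x : ℝ} {y : T} (hy : x ≤ L.r y) :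
    L.lower G x ≤ L.r (G y) := by
  refine csInf_le ⟨x - B, ?_⟩ ⟨y, hy, rfl⟩
  rintro _ ⟨z, hz, rfl⟩
  linarith [(abs_le.1 (hB z)).1]

theorem le_lower {x v : ℝ} (h : ∀ y, x ≤ L.r y → v ≤ L.r (G y)) : v ≤ L.lower G x :=
  le_csInf ⟨_, L.h x, by simp, rfl⟩ (by rintro _ ⟨y, hy, rfl⟩; exact h y hy)

theorem exists_upper_lift (hG : L.IsDegreeOne G) (hB : ∀ y, |L.r (G y) - L.r y| ≤ B) :
    ∃ f : CircleDeg1Lift, ⇑f = L.upper G := by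
  refine ⟨⟨⟨L.upper G, fun x y hxy => upper_le fun z hz => le_upper hB (hz.trans hxy)⟩,
    fun x => ?_⟩, rfl⟩
  change L.upper G (x + 1) = L.upper G x + 1
  apply le_antisymm
  · refine upper_le fun y hy => ?_
    obtain ⟨z, rfl⟩ := L.τ.surjective y
    rw [r_τ] at hy
    rw [hG.2, r_τ]
    linarith [le_upper hB (x := x) (y := z) (by linarith)]
  · rw [← le_sub_iff_add_le]
    refine upper_le fun y hy => ?_
    have h := le_upper hB (x := x + 1) (y := L.τ y) (by rw [r_τ]; linarith)
    rw [hG.2, r_τ] at h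
    linarith

theorem exists_lower_lift (hG : L.IsDegreeOne G) (hB : ∀ y, |L.r (G y) - L.r y| ≤ B) :
    ∃ f : CircleDeg1Lift, ⇑f = L.lower G := by
  refine ⟨⟨⟨L.lower G, fun x y hxy => le_lower fun z hz => lower_le hB (hxy.trans hz)⟩,
    fun x => ?_⟩, rfl⟩
  change L.lower G (x + 1) = L.lower G x + 1
  apply le_antisymm
  · rw [← sub_le_iff_le_add]
    refine le_lower fun y hy => ?_
    have h := lower_le hB (x := x + 1) (y := L.τ y) (by rw [r_τ]; linarith)
    rw [hG.2, r_τ] at h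
    linarith
  · refine le_lower fun y hy => ?_
    obtain ⟨z, rfl⟩ := L.τ.surjective y
    rw [r_τ] at hy
    rw [hG.2, r_τ]
    linarith [lower_le hB (x := x) (y := z) (by linarith)]

theorem r_iterate_le (hB : ∀ y, |L.r (G y) - L.r y| ≤ B) (n : ℕ) (y : T) :
    L.r (G^[n] y) ≤ (L.upper G)^[n] (L.r y) := by
  induction n with
  | zero => rfl
  | succ n ih =>
    rw [Function.iterate_succ_apply', Function.iterate_succ_apply']
    exact le_upper hB ih

theorem le_r_iterate (hB : ∀ y, |L.r (G y) - L.r y| ≤ B) (n : ℕ) (y : T) :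
    (L.lower G)^[n] (L.r y) ≤ L.r (G^[n] y) := by
  induction n with
  | zero => rfl
  | succ n ih =>
    rw [Function.iterate_succ_apply', Function.iterate_succ_apply']
    exact lower_le hB ih

theorem upperRot_le (hB : ∀ y, |L.r (G y) - L.r y| ≤ B) {b : ℝ}
    (hb : HasRotationNumber (L.upper G) b) (y : T) : L.upperRot G y ≤ b := by
  have ht : Tendsto (fun n : ℕ => ((((L.upper G)^[n] (L.r y) - L.r y) / n : ℝ) : EReal)) atTop
      (𝓝 (b : EReal)) := (continuous_coe_real_ereal.tendsto b).comp (hb (L.r y))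
  rw [← ht.limsup_eq]
  refine limsup_le_limsup (Eventually.of_forall fun n => ?_)
  rw [EReal.coe_le_coe_iff]
  exact div_le_div_of_nonneg_right (sub_le_sub_right (r_iterate_le hB n y) _) n.cast_nonneg

theorem le_lowerRot (hB : ∀ y, |L.r (G y) - L.r y| ≤ B) {a : ℝ}
    (ha : HasRotationNumber (L.lower G) a) (y : T) : (a : EReal) ≤ L.lowerRot G y := by
  have ht : Tendsto (fun n : ℕ => ((((L.lower G)^[n] (L.r y) - L.r y) / n : ℝ) : EReal)) atTop
      (𝓝 (a : EReal)) := (continuous_coe_real_ereal.tendsto a).comp (ha (L.r y))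
  rw [← ht.liminf_eq]
  refine liminf_le_liminf (Eventually.of_forall fun n => ?_)
  rw [EReal.coe_le_coe_iff]
  exact div_le_div_of_nonneg_right (sub_le_sub_right (le_r_iterate hB n y) _) n.cast_nonneg

end Bounds

theorem lowerRot_le_upperRot (F : T → T) (y : T) : L.lowerRot F y ≤ L.upperRot F y :=
  liminf_le_limsup

theorem hasRot_of_tendsto {F : T → T} {y : T} {α : ℝ} (h : Tendsto (L.avg F y) atTop (𝓝 α)) :
    L.HasRot F y α := by
  have ht : Tendsto (fun n : ℕ => (L.avg F y n : EReal)) atTop (𝓝 (α : EReal)) :=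
    (continuous_coe_real_ereal.tendsto α).comp h
  exact ⟨ht.liminf_eq, ht.limsup_eq⟩

/-! ### Degree one maps and their retraction to the line -/

section DegreeOne

variable {L} {F : T → T}

theorem IsDegreeOne.map_τ_zpow (hF : L.IsDegreeOne F) (m : ℤ) (y : T) :
    F ((L.τ ^ m) y) = (L.τ ^ m) (F y) := by
  have hinv : ∀ y, F (L.τ⁻¹ y) = L.τ⁻¹ (F y) := fun y => by
    apply L.τ.injective
    rw [← hF.2, ← Homeomorph.mul_apply, ← Homeomorph.mul_apply, mul_inv_cancel,
      Homeomorph.one_apply, Homeomorph.one_apply]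
  induction m using Int.induction_on generalizing y with
  | zero => simp
  | succ i ih => rw [zpow_add_one, Homeomorph.mul_apply, Homeomorph.mul_apply, ih, hF.2]
  | pred i ih => rw [zpow_sub_one, Homeomorph.mul_apply, Homeomorph.mul_apply, ih, hinv]

theorem IsDegreeOne.iterate_τ_zpow (hF : L.IsDegreeOne F) (n : ℕ) (m : ℤ) (y : T) :
    F^[n] ((L.τ ^ m) y) = (L.τ ^ m) (F^[n] y) := by
  induction n with
  | zero => rfl
  | succ n ih => rw [Function.iterate_succ_apply', ih, hF.map_τ_zpow, Function.iterate_succ_apply']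

theorem IsDegreeOne.continuous_retract (hF : L.IsDegreeOne F) : Continuous (L.retract F) :=
  L.continuous_r_comp (hF.1.comp L.isEmbedding_h.continuous)

theorem IsDegreeOne.retract_add_one (hF : L.IsDegreeOne F) (t : ℝ) :
    L.retract F (t + 1) = L.retract F t + 1 := by
  rw [retract, ← L.τ_h, hF.2, r_τ, retract]

theorem IsDegreeOne.retract_add_int (hF : L.IsDegreeOne F) (t : ℝ) (m : ℤ) :
    L.retract F (t + m) = L.retract F t + m := by
  rw [retract, ← L.τ_zpow_h, hF.map_τ_zpow, r_τ_zpow, retract]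

theorem IsDegreeOne.apply_h_eq (hF : L.IsDegreeOne F) {t : ℝ} (ht : t ∉ constSet (L.retract F)) :
    F (L.h t) = L.h (L.retract F t) := by
  by_cases hr : F (L.h t) ∈ range L.h
  · exact L.eq_h_of_mem_range hr
  · exact absurd (L.mem_constSet_of_notMem_range (c := fun u => F (L.h u))
      (hF.1.comp L.isEmbedding_h.continuous) hr) ht

theorem IsDegreeOne.iterate_h_eq (hF : L.IsDegreeOne F) {t : ℝ}
    (ht : ∀ n, (L.retract F)^[n] t ∉ constSet (L.retract F)) (n : ℕ) :
    F^[n] (L.h t) = L.h ((L.retract F)^[n] t) := by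
  induction n with
  | zero => rfl
  | succ n ih =>
    rw [Function.iterate_succ_apply', ih, hF.apply_h_eq (ht n), Function.iterate_succ_apply']

/-- An orbit (mod 1) of the retracted map which avoids its flat pieces is an orbit of the map. -/
theorem IsDegreeOne.twist_orbit_of_retract (hF : L.IsDegreeOne F) {t α : ℝ}
    (ht : ∀ n, (L.retract F)^[n] t ∉ constSet (L.retract F))
    (hmono : StrictMonoOn (L.retract F) {u | ∃ (n : ℕ) (m : ℤ), u = (L.retract F)^[n] t + m})
    (hrot : ∀ n, Tendsto (fun k : ℕ => ((L.retract F)^[k] ((L.retract F)^[n] t) -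
      (L.retract F)^[n] t) / k) atTop (𝓝 α)) :
    L.IsTwistOrbit F (L.orb F (L.h t)) ∧
      Disjoint (L.orb F (L.h t)) (L.h '' constSet (F ∘ L.h)) ∧
      ∀ x ∈ L.orb F (L.h t), L.HasRot F x α := by
  have horb : ∀ (n : ℕ) (m : ℤ), (L.τ ^ m) (F^[n] (L.h t)) =
      L.h ((L.retract F)^[n] t + m) := fun n m => by
    rw [hF.iterate_h_eq ht, L.τ_zpow_h]
  refine ⟨⟨⟨_, rfl⟩, ?_, hmono.mono ?_⟩, ?_, ?_⟩
  · rintro _ ⟨n, m, rfl⟩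
    exact ⟨_, (horb n m).symm⟩
  · rintro u ⟨n, m, hu⟩
    rw [horb] at hu
    exact ⟨n, m, L.h_injective hu⟩
  · rw [Set.disjoint_left]
    rintro _ ⟨n, m, rfl⟩ ⟨u, hu, hum⟩
    rw [horb] at hum
    obtain rfl := L.h_injective hum
    refine ht n ?_
    have hcont : ContinuousAt (fun v : ℝ => v + (m : ℝ)) ((L.retract F)^[n] t) := by fun_prop
    have hev : ∀ᶠ v in 𝓝 ((L.retract F)^[n] t), (F ∘ L.h) (v + m) =
      (F ∘ L.h) ((L.retract F)^[n] t + m) := hcont.eventually hu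
    refine hev.mono fun v hv => ?_
    have h2 : L.retract F (v + m) = L.retract F ((L.retract F)^[n] t + m) := congrArg L.r hv
    rw [hF.retract_add_int, hF.retract_add_int] at h2
    linarith
  · rintro _ ⟨n, m, rfl⟩
    refine L.hasRot_of_tendsto ((hrot n).congr fun k => ?_)
    rw [avg, hF.iterate_τ_zpow, r_τ_zpow, r_τ_zpow, ← Function.iterate_add_apply F,
      hF.iterate_h_eq ht, hF.iterate_h_eq ht, r_h, r_h, ← Function.iterate_add_apply]
    ring

/-! ### Combed maps -/

/-- Combing transfers the bound from the line. A value over x is taken at some t ≥ x, which bounds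
it below, and at some t ≤ x, which bounds it above. -/
theorem Combed.exists_displacement_bound (hF : L.IsDegreeOne F) (hcomb : L.Combed F) :
    ∃ B, ∀ y, |L.r (F y) - L.r y| ≤ B := by
  obtain ⟨B, hB⟩ := exists_abs_sub_le_of_map_add_one hF.continuous_retract hF.retract_add_one
  refine ⟨B, fun y => abs_le.2 ⟨?_, ?_⟩⟩
  · obtain ⟨_, ⟨t, ht, rfl⟩, hty⟩ := (hcomb (L.r y)).2 ⟨y, rfl, rfl⟩
    have h1 := (abs_le.1 (hB t)).1
    have h2 : L.retract F t = L.r (F y) := hty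
    have h3 : L.r y ≤ t := ht
    linarith
  · obtain ⟨_, ⟨t, ht, rfl⟩, hty⟩ := (hcomb (L.r y)).1 ⟨y, rfl, rfl⟩
    have h1 := (abs_le.1 (hB t)).2
    have h2 : L.retract F t = L.r (F y) := hty
    have h3 : t ≤ L.r y := ht
    linarith

theorem Combed.upper_eq (hF : L.IsDegreeOne F) (hcomb : L.Combed F) :
    L.upper F = runSup (L.retract F) := by
  obtain ⟨B, hB⟩ := exists_abs_sub_le_of_map_add_one hF.continuous_retract hF.retract_add_one
  obtain ⟨B', hB'⟩ := Combed.exists_displacement_bound hF hcomb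
  ext x
  refine le_antisymm (upper_le fun y hy => ?_) (runSup_le fun t ht => le_upper hB' (by simpa))
  obtain ⟨_, ⟨t, ht, rfl⟩, hty⟩ := (hcomb (L.r y)).1 ⟨y, rfl, rfl⟩
  simp only at hty
  rw [← hty]
  exact le_runSup hB ((mem_Iic.1 ht).trans hy)

theorem Combed.lower_eq (hF : L.IsDegreeOne F) (hcomb : L.Combed F) :
    L.lower F = runInf (L.retract F) := by
  obtain ⟨B, hB⟩ := exists_abs_sub_le_of_map_add_one hF.continuous_retract hF.retract_add_one
  obtain ⟨B', hB'⟩ := Combed.exists_displacement_bound hF hcomb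
  ext x
  refine le_antisymm (le_runInf fun t ht => lower_le hB' (by simpa)) (le_lower fun y hy => ?_)
  obtain ⟨_, ⟨t, ht, rfl⟩, hty⟩ := (hcomb (L.r y)).2 ⟨y, rfl, rfl⟩
  simp only at hty
  rw [← hty]
  exact runInf_le hB (hy.trans (mem_Ici.1 ht))

/-! ### The distance on maps -/

theorem abs_r_sub_r_le_ν (x y : T) : |L.r x - L.r y| ≤ L.ν x y := by
  rw [ν]
  split_ifs with h
  · rw [L.r_eq_of_mem_closure h.1 (subset_closure h.2), sub_self, abs_zero]
    exact dist_nonneg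
  · have h1 := dist_nonneg (x := x) (y := L.h (L.r x))
    have h2 := dist_nonneg (x := L.h (L.r y)) (y := y)
    linarith

theorem abs_r_sub_r_le_of_supDist_lt {G : T → T} {η : ℝ}
    (h : L.supDist F G < ENNReal.ofReal η) (x : T) : |L.r (G x) - L.r (F x)| ≤ η := by
  have h1 : ENNReal.ofReal (L.ν (F x) (G x)) < ENNReal.ofReal η :=
    (le_iSup (fun x => ENNReal.ofReal (L.ν (F x) (G x))) x).trans_lt h
  have h2 := (ENNReal.ofReal_lt_ofReal_iff'.1 h1).1
  rw [abs_sub_comm]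
  exact (abs_r_sub_r_le_ν _ _).trans h2.le

theorem abs_upper_sub_upper_le {G : T → T} {B B' η : ℝ} (hB : ∀ y, |L.r (F y) - L.r y| ≤ B)
    (hB' : ∀ y, |L.r (G y) - L.r y| ≤ B') (h : ∀ x, |L.r (G x) - L.r (F x)| ≤ η) (x : ℝ) :
    |L.upper G x - L.upper F x| ≤ η := by
  have h1 : L.upper G x ≤ L.upper F x + η := upper_le fun y hy => by
    linarith [le_upper hB hy, (abs_le.1 (h y)).2]
  have h2 : L.upper F x ≤ L.upper G x + η := upper_le fun y hy => by
    linarith [le_upper hB' hy, (abs_le.1 (h y)).1]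
  exact abs_le.2 ⟨by linarith, by linarith⟩

theorem abs_lower_sub_lower_le {G : T → T} {B B' η : ℝ} (hB : ∀ y, |L.r (F y) - L.r y| ≤ B)
    (hB' : ∀ y, |L.r (G y) - L.r y| ≤ B') (h : ∀ x, |L.r (G x) - L.r (F x)| ≤ η) (x : ℝ) :
    |L.lower G x - L.lower F x| ≤ η := by
  have h1 : L.lower F x - η ≤ L.lower G x := le_lower fun y hy => by
    linarith [lower_le hB hy, (abs_le.1 (h y)).1]
  have h2 : L.lower G x - η ≤ L.lower F x := le_lower fun y hy => by
    linarith [lower_le hB' hy, (abs_le.1 (h y)).2]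
  exact abs_le.2 ⟨by linarith, by linarith⟩

/-- The rotation numbers of `F_l` and `F_u` depend continuously on the map at combed maps. -/
theorem Combed.exists_rotationNumber_near (hF : L.IsDegreeOne F) (hcomb : L.Combed F) {a b : ℝ}
    (ha : HasRotationNumber (L.lower F) a) (hb : HasRotationNumber (L.upper F) b) {ε : ℝ}
    (hε : 0 < ε) : ∃ η > 0, ∀ G : T → T, L.IsDegreeOne G →
      L.supDist F G < ENNReal.ofReal η → ∃ a' b' : ℝ, HasRotationNumber (L.lower G) a' ∧
        HasRotationNumber (L.upper G) b' ∧ |a' - a| < ε ∧ |b' - b| < ε := by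
  obtain ⟨B₀, hB₀⟩ := exists_abs_sub_le_of_map_add_one hF.continuous_retract hF.retract_add_one
  obtain ⟨B, hB⟩ := Combed.exists_displacement_bound hF hcomb
  obtain ⟨fl, hfl⟩ := exists_lower_lift hF hB
  obtain ⟨fu, hfu⟩ := exists_upper_lift hF hB
  have hla : fl.translationNumber = a :=
    tendsto_nhds_unique (fl.hasRotationNumber 0) (by rw [hfl]; exact ha 0)
  have hub : fu.translationNumber = b :=
    tendsto_nhds_unique (fu.hasRotationNumber 0) (by rw [hfu]; exact hb 0)
  -- Continuity is needed only for the maps attached to F, where combing identifies them with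
  -- running extrema. Those attached to G need only be monotone of degree one.
  obtain ⟨η₁, hη₁, h₁⟩ := fl.exists_translationNumber_near
    (by rw [hfl, Combed.lower_eq hF hcomb]; exact runInf_continuous hB₀ hF.continuous_retract) hε
  obtain ⟨η₂, hη₂, h₂⟩ := fu.exists_translationNumber_near
    (by rw [hfu, Combed.upper_eq hF hcomb]; exact runSup_continuous hB₀ hF.continuous_retract) hε
  refine ⟨min η₁ η₂, lt_min hη₁ hη₂, fun G hG hFG => ?_⟩
  have hd := abs_r_sub_r_le_of_supDist_lt hFG
  have hB' : ∀ y, |L.r (G y) - L.r y| ≤ min η₁ η₂ + B := fun y =>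
    (abs_sub_le _ (L.r (F y)) _).trans (add_le_add (hd y) (hB y))
  obtain ⟨gl, hgl⟩ := exists_lower_lift hG hB'
  obtain ⟨gu, hgu⟩ := exists_upper_lift hG hB'
  refine ⟨gl.translationNumber, gu.translationNumber, ?_, ?_, ?_, ?_⟩
  · rw [← hgl]; exact gl.hasRotationNumber
  · rw [← hgu]; exact gu.hasRotationNumber
  · rw [← hla]
    refine h₁ gl fun x => ?_
    rw [hgl, hfl]
    exact (abs_lower_sub_lower_le hB hB' hd x).trans (min_le_left _ _)
  · rw [← hub]
    refine h₂ gu fun x => ?_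
    rw [hgu, hfu]
    exact (abs_upper_sub_upper_le hB hB' hd x).trans (min_le_right _ _)

end DegreeOne

end LiftedSpace

/-! ### The main theorem -/

theorem mainTheorem4 {T : Type*} [MetricSpace T] (L : LiftedSpace T) (F : T → T)
    (hF : L.IsDegreeOne F) (hcomb : L.Combed F) :
    ∃ a b : ℝ, HasRotationNumber (L.lower F) a ∧ HasRotationNumber (L.upper F) b ∧ a ≤ b ∧
      -- equality of the rotation sets
      L.rotSet F = Icc a b ∧
      realRotSet (L.retract F) = L.rotSet F ∧
      L.rotSetR F = L.rotSet F ∧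
      L.rotSetPlus F = Real.toEReal '' L.rotSet F ∧
      L.rotSetMinus F = Real.toEReal '' L.rotSet F ∧
      -- twist orbits
      (∀ α ∈ L.rotSet F, ∃ P : Set T, L.IsTwistOrbit F P ∧
        Disjoint P (L.h '' constSet (F ∘ L.h)) ∧ ∀ x ∈ P, L.HasRot F x α) ∧
      -- periodic twist orbits
      (∀ q : ℚ, (q : ℝ) ∈ L.rotSet F → ∃ P : Set T, L.IsTwistOrbit F P ∧
        Disjoint P (L.h '' constSet (F ∘ L.h)) ∧ (∀ x ∈ P, L.HasRot F x q) ∧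
        L.IsPeriodicOrbit F P) ∧
      -- continuity of the endpoints at `F`
      ((∀ x y : T, dist (L.τ x) (L.τ y) = dist x y) →
        ∀ ε > 0, ∃ η > 0, ∀ G : T → T, L.IsDegreeOne G → L.supDist F G < ENNReal.ofReal η →
          ∃ a' b' : ℝ, HasRotationNumber (L.lower G) a' ∧ HasRotationNumber (L.upper G) b' ∧
            |a' - a| < ε ∧ |b' - b| < ε) := by
  obtain ⟨B, hB⟩ := LiftedSpace.Combed.exists_displacement_bound hF hcomb
  obtain ⟨fl, hfl⟩ := LiftedSpace.exists_lower_lift hF hB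
  obtain ⟨fu, hfu⟩ := LiftedSpace.exists_upper_lift hF hB
  have ha : HasRotationNumber (L.lower F) fl.translationNumber := hfl ▸ fl.hasRotationNumber
  have hb : HasRotationNumber (L.upper F) fu.translationNumber := hfu ▸ fu.hasRotationNumber
  have hbounds : ∀ y, (fl.translationNumber : EReal) ≤ L.lowerRot F y ∧
      L.lowerRot F y ≤ L.upperRot F y ∧ L.upperRot F y ≤ fu.translationNumber := fun y =>
    ⟨LiftedSpace.le_lowerRot hB ha y, L.lowerRot_le_upperRot F y, LiftedSpace.upperRot_le hB hb y⟩
  have hab : fl.translationNumber ≤ fu.translationNumber := by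
    obtain ⟨h1, h2, h3⟩ := hbounds (L.h 0)
    exact EReal.coe_le_coe_iff.1 (h1.trans (h2.trans h3))
  -- Upper and lower rotation numbers are extended reals; finite bounds on both sides make them
  -- real.
  have hreal : ∀ v : EReal, (fl.translationNumber : EReal) ≤ v → v ≤ fu.translationNumber →
      ∃ α ∈ Icc fl.translationNumber fu.translationNumber, (α : EReal) = v := by
    intro v h1 h2
    lift v to ℝ using ⟨fun h => by simp [h] at h2, fun h => by simp [h] at h1⟩
    exact ⟨v, ⟨EReal.coe_le_coe_iff.1 h1, EReal.coe_le_coe_iff.1 h2⟩, rfl⟩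
  have hexists : ∀ α ∈ Icc fl.translationNumber fu.translationNumber, ∃ t : ℝ,
      (L.IsTwistOrbit F (L.orb F (L.h t)) ∧
        Disjoint (L.orb F (L.h t)) (L.h '' constSet (F ∘ L.h)) ∧
        ∀ x ∈ L.orb F (L.h t), L.HasRot F x α) ∧
      Tendsto (fun n : ℕ => ((L.retract F)^[n] t - t) / n) atTop (𝓝 α) ∧
      ∀ q : ℚ, α = q → L.IsPeriodicPt F (L.h t) := by
    intro α hα
    obtain ⟨t, ht, hmono, hrot, hper⟩ := exists_twist_orbit_real hF.continuous_retract
      hF.retract_add_one (LiftedSpace.Combed.lower_eq hF hcomb ▸ ha)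
      (LiftedSpace.Combed.upper_eq hF hcomb ▸ hb) hα
    refine ⟨t, hF.twist_orbit_of_retract ht hmono hrot, hrot 0, fun q hq =>
      ⟨q.den, q.den_pos, q.num, ?_⟩⟩
    rw [hF.iterate_h_eq ht, hper q hq, L.τ_zpow_h]
  have hself : ∀ t, L.h t ∈ L.orb F (L.h t) := fun t => ⟨0, 0, by simp⟩
  have hrotSet : L.rotSet F = Icc fl.translationNumber fu.translationNumber := by
    ext α
    constructor
    · rintro ⟨y, hy1, hy2⟩
      obtain ⟨h1, -, h3⟩ := hbounds y
      rw [hy1] at h1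
      rw [hy2] at h3
      exact ⟨EReal.coe_le_coe_iff.1 h1, EReal.coe_le_coe_iff.1 h3⟩
    · intro hα
      obtain ⟨t, ⟨-, -, ht⟩, -⟩ := hexists α hα
      exact ⟨L.h t, ht _ (hself t)⟩
  refine ⟨_, _, ha, hb, hab, hrotSet, ?_, ?_, ?_, ?_, ?_, ?_, fun _ ε hε =>
    LiftedSpace.Combed.exists_rotationNumber_near hF hcomb ha hb hε⟩ <;> rw [hrotSet]
  · ext α
    constructor
    · rintro ⟨t, ht⟩
      have hit : ∀ n, (L.lower F)^[n] t ≤ (L.retract F)^[n] t ∧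
          (L.retract F)^[n] t ≤ (L.upper F)^[n] t := by
        intro n
        induction n with
        | zero => exact ⟨le_rfl, le_rfl⟩
        | succ n ih =>
          simp only [Function.iterate_succ_apply']
          exact ⟨LiftedSpace.lower_le hB (by simpa using ih.1),
            LiftedSpace.le_upper hB (by simpa using ih.2)⟩
      exact ⟨le_of_tendsto_of_tendsto' (ha t) ht fun n =>
          div_le_div_of_nonneg_right (sub_le_sub_right (hit n).1 _) n.cast_nonneg,
        le_of_tendsto_of_tendsto' ht (hb t) fun n =>
          div_le_div_of_nonneg_right (sub_le_sub_right (hit n).2 _) n.cast_nonneg⟩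
    · intro hα
      obtain ⟨t, -, ht, -⟩ := hexists α hα
      exact ⟨t, ht⟩
  · refine subset_antisymm ?_ fun α hα => ?_
    · rw [← hrotSet]
      rintro α ⟨t, ht⟩
      exact ⟨L.h t, ht⟩
    · obtain ⟨t, ⟨-, -, ht⟩, -⟩ := hexists α hα
      exact ⟨t, ht _ (hself t)⟩
  · refine subset_antisymm ?_ ?_
    · rintro _ ⟨y, rfl⟩
      obtain ⟨h1, h2, h3⟩ := hbounds y
      exact hreal _ (h1.trans h2) h3
    · rintro _ ⟨α, hα, rfl⟩
      obtain ⟨t, ⟨-, -, ht⟩, -⟩ := hexists α hα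
      exact ⟨L.h t, (ht _ (hself t)).2⟩
  · refine subset_antisymm ?_ ?_
    · rintro _ ⟨y, rfl⟩
      obtain ⟨h1, h2, h3⟩ := hbounds y
      exact hreal _ h1 (h2.trans h3)
    · rintro _ ⟨α, hα, rfl⟩
      obtain ⟨t, ⟨-, -, ht⟩, -⟩ := hexists α hα
      exact ⟨L.h t, (ht _ (hself t)).1⟩
  · intro α hα
    obtain ⟨t, ht, -⟩ := hexists α hα
    exact ⟨_, ht⟩
  · intro q hq
    obtain ⟨t, ⟨h1, h2, h3⟩, -, hper⟩ := hexists q hq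
    exact ⟨_, h1, h2, h3, L.h t, hper q rfl, rfl⟩
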